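/- **Setting.** Let $I=(-1,1)$, $\rho_0>0$, $\rho(x)=\rho_0(1-x^2)$, $\tau>0$, and consider the Sellers type energy balance model with memory $$ \begin{cases} u_t-(\rho(x)u_x)_x=r(t)q(x)\beta(u)-\varepsilon(u)|u|^3u+f(H(t,x,u)), & t>0,\ x\in I,\\ \rho(x)u_x=0, & t>0,\ x\in\partial I,\\ u(s,x)=u_0(s,x), & s\in[-\tau,0],\ x\in I, \end{cases} \qquad H(t,x,u)=\int_{-\tau}^0k(s,x)\,u(t+s,x)\,ds. \tag{1} $$ Assume $r\in C^1(\mathbb R_+)$ with $r,r'\in L^\infty(\mathbb R_+)$; $\beta\in C^2(\mathbb R)$ with $\beta,\beta',\beta''\in L^\infty(\mathbb R)$; $\varepsilon\in C^1(\mathbb R)$ with $\varepsilon,\varepsilon'\in L^\infty(\mathbb R)$ and $\varepsilon\ge\varepsilon_1$ for some constant $\varepsilon_1>0$; $f\in C^1(\mathbb R)$ with $f,f'\in L^\infty(\mathbb R)$ and $f,f'$ Lipschitz; $k\in C^1([-\tau,0]\times[-1,1])$. Let $V$ be the space of $w\in L^2(I)$ that are locally absolutely continuous in $I$ with $\sqrt\rho\,w_x\in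 L^2(I)$, normed by $\|w\|_{L^2(I)}+\|\sqrt\rho\,w_x\|_{L^2(I)}$; let $D(A)=\{w\in V:\rho w_x\in H^1(I)\}$, $Aw=(\rho w_x)_x$, and let $(e^{tA})_{t\ge0}$ be the strongly continuous semigroup on $L^2(I)$ with infinitesimal generator $(A,D(A))$. For $T>0$, a *(mild) solution* of (1) on $[0,T]$ is a function $u\in H^1(0,T;L^2(I))\cap L^2(0,T;D(A))\cap C([-\tau,T];V)$ such that $u=u_0$ on $[-\tau,0]$ and, for all $t\in[0,T]$, $$u(t)=e^{tA}u_0(0)+\int_0^te^{(t-s)A}\Bigl(r(s)\,q\,\beta(u(s))-\varepsilon(u(s))|u(s)|^3u(s)+f(H(s,\cdot,u))\Bigr)ds .$$ A continuous function $\psi$ on $I$ is *piecewise analytic* if there are points $-1=p_1<\dots<p_n=1$ and functions $\varphi_j$, analytic on $[p_j,p_{j+1}]$, such that $\psi=\sum_{j=1}^{n-1}\chi_{[p_j,p_{j+1})}\varphi_j$ on $I$. **Theorem (uniqueness from pointwise observation).** Let $q,\tilde q$ be Lipschitz continuous and piecewise analytic on $I$, let $u_0\in C^{1,2}([-\tau,0]\times[-1,1])$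 (that is, $u_0,\partial_tu_0,\partial_xu_0,\partial_{xx}u_0$ exist and are continuous on the closed rectangle), let $T>0$, and let $u$ and $\tilde u$ be the solutions on $[0,T]$ of (1) with insolation functions $q$ and $\tilde q$ respectively and with the same initial datum $u_0$. Assume that - there is $\delta\in(0,\tau)$ with $k(s,\cdot)\equiv0$ for all $s\in[-\delta,0]$; - $r>0$ on $\mathbb R_+=[0,\infty)$ and $\beta>0$ on $\mathbb R$; - there is $x_0\in I$ such that $u(t,x_0)=\tilde u(t,x_0)$ and $u_x(t,x_0)=\tilde u_x(t,x_0)$ for all $t\in(0,T)$. Then $q\equiv\tilde q$ on $I$. -/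

import Mathlib

open Set Filter Topology MeasureTheory
open scoped ENNReal NNReal ContDiff

namespace EBM

/-- The space domain `I = (-1, 1)`. -/
abbrev I : Set ℝ := Ioo (-1) 1

/-- Lebesgue measure on `I`. -/
noncomputable abbrev volI : Measure ℝ := volume.restrict I

/-- The real Hilbert space `L²(I)`. -/
abbrev L2I : Type := Lp ℝ 2 volI

open Classical in
/-- The class in `L²(I)` of a square integrable function (and `0` if `w` is not in `L²(I)`). -/
noncomputable def toL2 (w : ℝ → ℝ) : L2I :=
  if h : MemLp w 2 volI then h.toLp w else 0

/-- The degenerate diffusion coefficient `ρ(x) = ρ₀ (1 - x²)`. -/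
def rho (ρ₀ x : ℝ) : ℝ := ρ₀ * (1 - x ^ 2)

/-- `w ∈ V`: `w ∈ L²(I)`, `w` is locally absolutely continuous in `I` and `√ρ w_x ∈ L²(I)`.
Only the values of `w` on `I` matter; `deriv w` is the a.e. derivative. -/
structure MemV (ρ₀ : ℝ) (w : ℝ → ℝ) : Prop where
  memLp : MemLp w 2 volI
  locallyAC : ∀ a ∈ I, ∀ b ∈ I, AbsolutelyContinuousOnInterval w a b
  memLp_deriv : MemLp (fun x => √(rho ρ₀ x) * deriv w x) 2 volI

/-- The norm of `V` (sum form), with values in `[0, ∞]`. -/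
noncomputable def normV (ρ₀ : ℝ) (w : ℝ → ℝ) : ℝ≥0∞ :=
  eLpNorm w 2 volI + eLpNorm (fun x => √(rho ρ₀ x) * deriv w x) 2 volI

/-- `u ∈ C([a, b]; V)`. -/
def ContinuousIntoV (ρ₀ a b : ℝ) (u : ℝ → ℝ → ℝ) : Prop :=
  (∀ t ∈ Icc a b, MemV ρ₀ (u t)) ∧
    ∀ t ∈ Icc a b,
      Tendsto (fun s => normV ρ₀ (fun x => u s x - u t x)) (𝓝[Icc a b] t) (𝓝 0)

/-- `g ∈ H¹(I)` with weak derivative `g_x = z ∈ L²(I)`. -/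
def HasH1Deriv (g : ℝ → ℝ) (z : L2I) : Prop :=
  MemLp g 2 volI ∧
    ∀ φ : ℝ → ℝ, ContDiff ℝ ∞ φ → HasCompactSupport φ → tsupport φ ⊆ I →
      ∫ x in I, g x * deriv φ x = -∫ x in I, z x * φ x

/-- `w ∈ D(A)` and `A w = z`, where `D(A) = {w ∈ V : ρ w_x ∈ H¹(I)}` and `A w = (ρ w_x)_x`. -/
def IsA (ρ₀ : ℝ) (w : ℝ → ℝ) (z : L2I) : Prop :=
  MemV ρ₀ w ∧ HasH1Deriv (fun x => rho ρ₀ x * deriv w x) z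

/-- `(S t)_{t ≥ 0}` is the strongly continuous semigroup `(e^{tA})_{t ≥ 0}` on `L²(I)`, that is, the
one whose infinitesimal generator is exactly the operator `(A, D(A))`. (A strongly continuous
semigroup is determined by its generator. Values `S t` at `t < 0` play no role.) -/
structure IsExpA (ρ₀ : ℝ) (S : ℝ → L2I →L[ℝ] L2I) : Prop where
  zero : S 0 = ContinuousLinearMap.id ℝ L2I
  add : ∀ s, 0 ≤ s → ∀ t, 0 ≤ t → S (s + t) = (S s).comp (S t)
  continuousOn : ∀ w : L2I, ContinuousOn (fun t => S t w) (Ici 0)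
  generator : ∀ w z : L2I,
    (∃ w' : ℝ → ℝ, w' =ᵐ[volI] w ∧ IsA ρ₀ w' z) ↔
      Tendsto (fun h : ℝ => h⁻¹ • (S h w - w)) (𝓝[>] 0) (𝓝 z)

/-- The history function `H(t, x, u) = ∫_{-τ}^0 k(s, x) u(t + s, x) ds`. -/
noncomputable def history (τ : ℝ) (k u : ℝ → ℝ → ℝ) (t x : ℝ) : ℝ :=
  ∫ s in (-τ)..0, k s x * u (t + s) x

/-- The right-hand side `r(t) q(x) β(u) - ε(u) |u|³ u + f(H)`. -/
noncomputable def source (τ : ℝ) (r q β ε f : ℝ → ℝ) (k u : ℝ → ℝ → ℝ) (t x : ℝ) : ℝ :=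
  r t * q x * β (u t x) - ε (u t x) * |u t x| ^ 3 * u t x + f (history τ k u t x)

/-- `u` is a mild solution on `[0, T]` of
`u_t - (ρ u_x)_x = r q β(u) - ε(u) |u|³ u + f(H)`, `ρ u_x = 0` at `x = ±1`,
`u = u₀` on `[-τ, 0]`. The boundary condition is contained in `D(A)`. -/
structure IsMildSolution (ρ₀ τ T : ℝ) (r q β ε f : ℝ → ℝ) (k u₀ u : ℝ → ℝ → ℝ) : Prop where
  /-- `u ∈ C([-τ, T]; V)`. -/
  continuousIntoV : ContinuousIntoV ρ₀ (-τ) T u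
  /-- `u ∈ H¹(0, T; L²(I))`: `u` is the integral of some `u_t ∈ L²(0, T; L²(I))`. -/
  memH1 : ∃ ut : ℝ → L2I, MemLp ut 2 (volume.restrict (Ioo 0 T)) ∧
    ∀ t ∈ Icc 0 T, toL2 (u t) = toL2 (u 0) + ∫ s in (0 : ℝ)..t, ut s
  /-- `u ∈ L²(0, T; D(A))`. -/
  memL2DA : ∃ Au : ℝ → L2I, MemLp Au 2 (volume.restrict (Ioo 0 T)) ∧
    ∀ᵐ t ∂(volume.restrict (Ioo 0 T)), IsA ρ₀ (u t) (Au t)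
  /-- The initial condition over the past. -/
  initial : ∀ s ∈ Icc (-τ) 0, ∀ x ∈ I, u s x = u₀ s x
  /-- `u(t) = e^{tA} u₀(0) + ∫₀ᵗ e^{(t-s)A} (G(s, u) + F(u^{(s)})) ds`. -/
  duhamel : ∃ S : ℝ → L2I →L[ℝ] L2I, IsExpA ρ₀ S ∧
    ∀ t ∈ Icc 0 T, toL2 (u t) = S t (toL2 (u₀ 0)) +
      ∫ s in (0 : ℝ)..t, S (t - s) (toL2 (source τ r q β ε f k u s))

/-- Standing assumptions on the coefficients of the Sellers type model with memory (except for the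
insolation function and the initial datum). -/
structure StandingAssumptions (ρ₀ τ : ℝ) (r β ε f : ℝ → ℝ) (k : ℝ → ℝ → ℝ) : Prop where
  rho_pos : 0 < ρ₀
  tau_pos : 0 < τ
  /-- `r ∈ C¹(ℝ₊)` and `r, r' ∈ L^∞(ℝ₊)`. -/
  r_C1 : ContDiffOn ℝ 1 r (Ici 0)
  r_bdd : ∃ M : ℝ, ∀ t, 0 ≤ t → |r t| ≤ M ∧ |derivWithin r (Ici 0) t| ≤ M
  /-- `β ∈ C²(ℝ)` and `β, β', β'' ∈ L^∞(ℝ)`. -/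
  beta_C2 : ContDiff ℝ 2 β
  beta_bdd : ∃ M : ℝ, ∀ v, |β v| ≤ M ∧ |deriv β v| ≤ M ∧ |deriv (deriv β) v| ≤ M
  /-- `ε ∈ C¹(ℝ)`, `ε, ε' ∈ L^∞(ℝ)` and `ε ≥ ε₁ > 0`. -/
  eps_C1 : ContDiff ℝ 1 ε
  eps_bdd : ∃ M : ℝ, ∀ v, |ε v| ≤ M ∧ |deriv ε v| ≤ M
  eps_pos : ∃ ε₁ : ℝ, 0 < ε₁ ∧ ∀ v, ε₁ ≤ ε v
  /-- `f ∈ C¹(ℝ)`, `f, f' ∈ L^∞(ℝ)`, and `f, f'` are `L`-Lipschitz. -/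
  f_C1 : ContDiff ℝ 1 f
  f_bdd : ∃ M : ℝ, ∀ v, |f v| ≤ M ∧ |deriv f v| ≤ M
  f_lip : ∃ L : ℝ≥0, LipschitzWith L f ∧ LipschitzWith L (deriv f)
  /-- `k ∈ C¹([-τ, 0] × [-1, 1])`. -/
  k_C1 : ContDiffOn ℝ 1 (Function.uncurry k) (Icc (-τ) 0 ×ˢ Icc (-1) 1)

/-- `u₀ ∈ C^{1,2}([-τ, 0] × [-1, 1])`: `u₀`, `∂_t u₀`, `∂_x u₀`, `∂_xx u₀` exist and are continuous on
the closed rectangle. -/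
def IsC12 (τ : ℝ) (u₀ : ℝ → ℝ → ℝ) : Prop :=
  ContinuousOn (Function.uncurry u₀) (Icc (-τ) 0 ×ˢ Icc (-1) 1) ∧
  ∃ ut ux uxx : ℝ → ℝ → ℝ,
    ContinuousOn (Function.uncurry ut) (Icc (-τ) 0 ×ˢ Icc (-1) 1) ∧
    ContinuousOn (Function.uncurry ux) (Icc (-τ) 0 ×ˢ Icc (-1) 1) ∧
    ContinuousOn (Function.uncurry uxx) (Icc (-τ) 0 ×ˢ Icc (-1) 1) ∧
    ∀ s ∈ Icc (-τ) 0, ∀ x ∈ Icc (-1 : ℝ) 1,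
      HasDerivWithinAt (fun s' => u₀ s' x) (ut s x) (Icc (-τ) 0) s ∧
      HasDerivWithinAt (u₀ s) (ux s x) (Icc (-1) 1) x ∧
      HasDerivWithinAt (ux s) (uxx s x) (Icc (-1) 1) x

/-- `ψ` is piecewise analytic on `I`: it is continuous and there are points
`-1 = p₀ < p₁ < ... < pₙ = 1` and functions `φⱼ`, analytic on `[pⱼ, pⱼ₊₁]`, such that
`ψ = ∑ⱼ χ_{[pⱼ, pⱼ₊₁)} φⱼ` on `I`. -/
def PiecewiseAnalytic (ψ : ℝ → ℝ) : Prop :=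
  ContinuousOn ψ I ∧
  ∃ (n : ℕ) (p : Fin (n + 1) → ℝ) (φ : Fin n → ℝ → ℝ),
    StrictMono p ∧ p 0 = -1 ∧ p (Fin.last n) = 1 ∧
    (∀ j : Fin n, AnalyticOnNhd ℝ (φ j) (Icc (p j.castSucc) (p j.succ))) ∧
    ∀ x ∈ I, ψ x = ∑ j : Fin n, (Ico (p j.castSucc) (p j.succ)).indicator (φ j) x

/-- The admissible insolation functions: Lipschitz continuous and piecewise analytic on `I`. -/
def Admissible (q : ℝ → ℝ) : Prop :=
  (∃ K : ℝ≥0, LipschitzOnWith K q I) ∧ PiecewiseAnalytic q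

end EBM

/-!
The difference `W = u - ũ` of the two solutions vanishes at `t = 0` and has zero Cauchy data at
`x₀`. Because `k` vanishes near `s = 0`, the history of both solutions coincides with that of the
datum `u₀` for `t ≤ δ`, so that on this time interval
`W_t - (ρ W_x)_x = r β(ũ) (q - q̃) + O(|W|)` locally in `I` (`StandingAssumptions.abs_source_sub_le`).
If `q ≠ q̃`, piecewise analyticity provides a point `x₁ ≠ x₀` with `q(x₁) ≠ q̃(x₁)` such that `q - q̃`
has one sign between `x₀` and `x₁` (`exists_signed_sub`); exchanging `u` and `ũ`, the sign may be
taken to be positive. Then, for small positive times, `W > 0` at `x₁` (`IsStrong.exists_pos`),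
`W ≥ 0` between `x₀` and `x₁` by comparison (`IsStrong.nonpos`), and `W_x ≠ 0` at `x₀` by a Hopf
lemma (`IsStrong.not_hasDerivAt_zero`), which contradicts the observation.

The maximum principles are needed for functions with little regularity. A function
`u ∈ C([-τ, T]; V)` is continuous on `[-τ, T] × I` and bounded by a multiple of a weight `ell`
whose eighth power is integrable (`exists_abs_le_ell`), hence the right-hand side of the equation is
a continuous path in `L²(I)`. Consequently a mild solution satisfies the equation in `L²(I)` at
almost every time (`IsExpA.tendsto_slope`, `IsMildSolution.isStrong`), and at such times it is
continuously differentiable in `I` by the du Bois-Reymond lemma (`IsA.exists_hasFlux`). For strong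
solutions in this sense the weak comparison principle on rectangles follows from an energy estimate
for the positive part, and everything else is obtained by comparison with explicit barriers, namely
finite sums of products `a(t) b(x)`.
-/

namespace EBM

/-! ### Absolutely continuous functions of one variable -/

theorem absolutelyContinuousOnInterval_of_dist_le {X Y : Type*} [PseudoMetricSpace X]
    [PseudoMetricSpace Y] {F : ℝ → X} {G : ℝ → Y} {a b : ℝ}
    (hG : AbsolutelyContinuousOnInterval G a b)
    (h : ∀ s ∈ uIcc a b, ∀ t ∈ uIcc a b, dist (F s) (F t) ≤ dist (G s) (G t)) :
    AbsolutelyContinuousOnInterval F a b := by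
  rw [absolutelyContinuousOnInterval_iff] at hG ⊢
  intro e he
  obtain ⟨d, hd, H⟩ := hG e he
  refine ⟨d, hd, fun E hE hs => lt_of_le_of_lt (Finset.sum_le_sum fun i hi => ?_) (H E hE hs)⟩
  exact h _ (hE.1 i hi).1 _ (hE.1 i hi).2

/-- Gronwall's inequality for an absolutely continuous function whose differential inequality holds
almost everywhere. -/
theorem nonpos_of_ae_deriv_le_mul {E : ℝ → ℝ} {a b K : ℝ}
    (hE : AbsolutelyContinuousOnInterval E a b) (ha : E a ≤ 0)
    (h : ∀ᵐ t, t ∈ Ioo a b → deriv E t ≤ K * E t) : ∀ t ∈ Icc a b, E t ≤ 0 := by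
  intro t ht
  have hE' : AbsolutelyContinuousOnInterval E a t :=
    hE.mono (by rw [uIcc_of_le ht.1, uIcc_of_le (ht.1.trans ht.2)]; exact Icc_subset_Icc_right ht.2)
  have hexp : AbsolutelyContinuousOnInterval (fun s => Real.exp (-K * s)) a t :=
    ContDiffOn.absolutelyContinuousOnInterval (by fun_prop)
  have hF := (hexp.fun_mul hE').integral_deriv_eq_sub
  have hle : ∫ s in a..t, deriv (fun s => Real.exp (-K * s) * E s) s ≤ 0 := by
    rw [intervalIntegral.integral_of_le ht.1]
    refine integral_nonpos_of_ae ?_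
    rw [EventuallyLE, ae_restrict_iff' measurableSet_Ioc]
    filter_upwards [h, hE'.ae_differentiableAt, (Measure.ae_ne volume t)] with s h1 h2 h3 hs
    have hd := (h2 (by rw [uIcc_of_le ht.1]; exact Ioc_subset_Icc_self hs)).hasDerivAt
    have he : HasDerivAt (fun s => Real.exp (-K * s)) (Real.exp (-K * s) * (-K * 1)) s :=
      ((hasDerivAt_id s).const_mul (-K)).exp
    rw [(he.fun_mul hd).deriv]
    have := h1 ⟨hs.1, lt_of_lt_of_le (lt_of_le_of_ne hs.2 h3) ht.2⟩
    have e := Real.exp_pos (-K * s)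
    simp only [Pi.zero_apply]
    nlinarith
  rw [hF] at hle
  have e1 := Real.exp_pos (-K * t)
  have e2 := Real.exp_pos (-K * a)
  by_contra! hc
  nlinarith [mul_pos e1 hc]

/-- `P` is a primitive of `z` on `I`, in integrated form: differences of `P` are interval integrals
of `z`. -/
def IsPrimitiveOnI (P z : ℝ → ℝ) : Prop :=
  ∀ x ∈ I, ∀ y ∈ I, P y - P x = ∫ s in x..y, z s

theorem uIcc_subset_I {x y : ℝ} (hx : x ∈ I) (hy : y ∈ I) : uIcc x y ⊆ I :=
  ordConnected_Ioo.uIcc_subset hx hy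

theorem uIoc_subset_I {x y : ℝ} (hx : x ∈ I) (hy : y ∈ I) : uIoc x y ⊆ I :=
  uIoc_subset_uIcc.trans (uIcc_subset_I hx hy)

theorem zero_mem_I : (0 : ℝ) ∈ I := by constructor <;> norm_num

theorem integrableOn_I_of_memLp {z : ℝ → ℝ} (hz : MemLp z 2 volI) : IntegrableOn z I :=
  hz.integrable one_le_two


theorem IsPrimitiveOnI.absolutelyContinuous {P z : ℝ → ℝ} (hP : IsPrimitiveOnI P z)
    (hz : IntegrableOn z I) {a b : ℝ} (ha : a ∈ I) (hb : b ∈ I) :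
    AbsolutelyContinuousOnInterval P a b := by
  have hi : IntervalIntegrable z volume a b :=
    intervalIntegrable_iff.mpr (hz.mono_set (uIoc_subset_I ha hb))
  refine absolutelyContinuousOnInterval_of_dist_le
    (hi.absolutelyContinuousOnInterval_intervalIntegral (c := a) left_mem_uIcc) ?_
  intro s hs t ht
  have hs' := uIcc_subset_I ha hb hs
  have ht' := uIcc_subset_I ha hb ht
  rw [← hP a ha s hs', ← hP a ha t ht', Real.dist_eq, Real.dist_eq]
  simp

theorem IsPrimitiveOnI.continuousOn {P z : ℝ → ℝ} (hP : IsPrimitiveOnI P z)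
    (hz : IntegrableOn z I) : ContinuousOn P I := by
  intro x hx
  obtain ⟨a, ha1, ha2⟩ := exists_between hx.1
  obtain ⟨b, hb1, hb2⟩ := exists_between hx.2
  have ha : a ∈ I := ⟨ha1, ha2.trans hx.2⟩
  have hb : b ∈ I := ⟨hx.1.trans hb1, hb2⟩
  have h := (hP.absolutelyContinuous hz ha hb).continuousOn
  rw [uIcc_of_le (ha2.trans hb1).le] at h
  exact (h.continuousAt (Icc_mem_nhds ha2 hb1)).continuousWithinAt

theorem IsPrimitiveOnI.ae_hasDerivAt {P z : ℝ → ℝ} (hP : IsPrimitiveOnI P z)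
    (hz : IntegrableOn z I) {a b : ℝ} (ha : a ∈ I) (hb : b ∈ I) :
    ∀ᵐ x, x ∈ uIcc a b → HasDerivAt P (z x) x := by
  have hi : IntervalIntegrable z volume a b :=
    intervalIntegrable_iff.mpr (hz.mono_set (uIoc_subset_I ha hb))
  filter_upwards [hi.ae_hasDerivAt_integral] with x hx hxm
  have hxI := uIcc_subset_I ha hb hxm
  refine ((hx hxm a left_mem_uIcc).const_add (P a)).congr_of_eventuallyEq ?_
  filter_upwards [isOpen_Ioo.mem_nhds hxI] with y hy
  rw [← hP a ha y hy]; ring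

/-- If `ρ y' = P` and `P' = z` on `[a, b]` while `y ≤ 0` at both ends, then testing `z` with the
positive part of `y` gives `∫ y⁺ z = -∫ ρ ((y⁺)')² ≤ 0`. -/
theorem integral_posPart_mul_le_zero {ρ y P z : ℝ → ℝ} {a b : ℝ} (hab : a ≤ b)
    (ha : a ∈ I) (hb : b ∈ I) (hρc : ContinuousOn ρ I) (hρ : ∀ x ∈ I, 0 < ρ x)
    (hy : ∀ x ∈ I, HasDerivAt y (P x / ρ x) x) (hP : IsPrimitiveOnI P z)
    (hz : IntegrableOn z I) (hya : y a ≤ 0) (hyb : y b ≤ 0) :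
    ∫ x in a..b, max (y x) 0 * z x ≤ 0 := by
  have hsub := uIcc_subset_I ha hb
  have hPac := hP.absolutelyContinuous hz ha hb
  have hcont : ContinuousOn (fun x => P x / ρ x) (uIcc a b) :=
    ((hP.continuousOn hz).div hρc fun x hx => (hρ x hx).ne').mono hsub
  obtain ⟨K, hK⟩ := isCompact_uIcc.exists_bound_of_continuousOn hcont
  have hylip : LipschitzOnWith K.toNNReal y (uIcc a b) := by
    refine (convex_uIcc a b).lipschitzOnWith_of_nnnorm_hasDerivWithin_le
      (fun x hx => (hy x (hsub hx)).hasDerivWithinAt) fun x hx => ?_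
    have := hK x hx
    rw [← NNReal.coe_le_coe]
    exact this.trans (Real.le_coe_toNNReal K)
  have hyac : AbsolutelyContinuousOnInterval (fun x => max (y x) 0) a b := by
    refine absolutelyContinuousOnInterval_of_dist_le hylip.absolutelyContinuousOnInterval ?_
    intro s _ t _
    rw [Real.dist_eq, Real.dist_eq]
    exact abs_max_sub_max_le_abs _ _ _
  have hparts := hyac.integral_mul_deriv_eq_deriv_mul hPac
  have hcongr : ∫ x in a..b, max (y x) 0 * z x = ∫ x in a..b, max (y x) 0 * deriv P x := by
    refine intervalIntegral.integral_congr_ae ?_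
    filter_upwards [hP.ae_hasDerivAt hz ha hb] with x hx hxm
    rw [(hx (uIoc_subset_uIcc hxm)).deriv]
  rw [hcongr, hparts, max_eq_right hya, max_eq_right hyb]
  have hpos : 0 ≤ ∫ x in a..b, deriv (fun x => max (y x) 0) x * P x := by
    refine intervalIntegral.integral_nonneg hab fun x hx => ?_
    have hxI := hsub (by rwa [uIcc_of_le hab])
    rcases lt_or_ge 0 (y x) with h | h
    · have hev : (fun x => max (y x) 0) =ᶠ[𝓝 x] y := by
        filter_upwards [(hy x hxI).continuousAt.eventually_const_lt h] with s hs
        exact max_eq_left hs.le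
      rw [hev.deriv_eq, (hy x hxI).deriv, div_mul_eq_mul_div]
      exact div_nonneg (mul_self_nonneg _) (hρ x hxI).le
    · -- At zeros of `y⁺` either the derivative vanishes or it does not exist and `deriv` is `0`.
      have hmin : IsLocalMin (fun x => max (y x) 0) x := by
        refine Eventually.of_forall fun s => ?_
        simp [max_eq_right h]
      rw [hmin.deriv_eq_zero, zero_mul]
  linarith

/-! ### Weak derivatives in one variable -/

theorem integral_primitive_mul_deriv {z φ : ℝ → ℝ} (hz : IntegrableOn z I)
    (hφ : ContDiff ℝ ∞ φ) (hsupp : tsupport φ ⊆ I) :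
    ∫ x in I, (∫ s in (0:ℝ)..x, z s) * deriv φ x = -∫ x in I, z x * φ x := by
  have hi : IntervalIntegrable z volume (-1) 1 :=
    (intervalIntegrable_iff_integrableOn_Ioo_of_le (by norm_num)).mpr hz
  have hac := hi.absolutelyContinuousOnInterval_intervalIntegral (c := 0)
    (by rw [uIcc_of_le (by norm_num)]; constructor <;> norm_num)
  have hφac : AbsolutelyContinuousOnInterval φ (-1) 1 :=
    ContDiffOn.absolutelyContinuousOnInterval (hφ.of_le (by exact_mod_cast le_top)).contDiffOn
  have h := hac.integral_mul_deriv_eq_deriv_mul hφac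
  have h1 : φ 1 = 0 := image_eq_zero_of_notMem_tsupport fun h => lt_irrefl _ (hsupp h).2
  have h2 : φ (-1) = 0 := image_eq_zero_of_notMem_tsupport fun h => lt_irrefl _ (hsupp h).1
  rw [h1, h2] at h
  have hc : ∫ x in (-1:ℝ)..1, deriv (fun x => ∫ s in (0:ℝ)..x, z s) x * φ x
      = ∫ x in (-1:ℝ)..1, z x * φ x := by
    refine intervalIntegral.integral_congr_ae ?_
    filter_upwards [hi.ae_hasDerivAt_integral] with x hx hxm
    rw [(hx (uIoc_subset_uIcc hxm) 0
      (by rw [uIcc_of_le (by norm_num)]; constructor <;> norm_num)).deriv]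
  have hIoo : ∀ g : ℝ → ℝ, ∫ x in (-1:ℝ)..1, g x = ∫ x in I, g x := fun g => by
    rw [intervalIntegral.integral_of_le (by norm_num), integral_Ioc_eq_integral_Ioo]
  rw [hc, hIoo, hIoo] at h
  rw [h]; ring

/-- The du Bois-Reymond lemma: a function with vanishing weak derivative is constant. -/
theorem ae_eq_const_of_integral_mul_deriv_eq_zero {e : ℝ → ℝ} (he : IntegrableOn e I)
    (h : ∀ φ : ℝ → ℝ, ContDiff ℝ ∞ φ → HasCompactSupport φ → tsupport φ ⊆ I →
      ∫ x in I, e x * deriv φ x = 0) :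
    ∃ c : ℝ, ∀ᵐ x, x ∈ I → e x = c := by
  let B : ContDiffBump (0:ℝ) := ⟨1/4, 1/2, by norm_num, by norm_num⟩
  set η := B.normed volume with hη
  have hηsm : ContDiff ℝ ∞ η := B.contDiff_normed
  have hηint : ∫ x, η x = 1 := B.integral_normed
  have hηcs : HasCompactSupport η := B.hasCompactSupport_normed
  have hηsupp : tsupport η ⊆ I := by
    rw [hη, B.tsupport_normed_eq]
    intro x hx
    rw [Metric.mem_closedBall, Real.dist_eq, sub_zero] at hx
    have : |x| ≤ 1/2 := hx
    have := abs_le.mp this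
    constructor <;> linarith
  have hmulint : ∀ g : ℝ → ℝ, Continuous g → HasCompactSupport g →
      IntegrableOn (fun x => e x * g x) I := by
    intro g hg hgc
    obtain ⟨C, hC⟩ := hgc.exists_bound_of_continuous hg
    exact he.mul_bdd hg.aestronglyMeasurable (ae_of_all _ hC)
  refine ⟨∫ x in I, e x * η x, ?_⟩
  set c := ∫ x in I, e x * η x with hc
  have key := isOpen_Ioo.ae_eq_zero_of_integral_contDiff_smul_eq_zero (μ := volume) (U := I)
    (f := fun x => e x - c) ?_ ?_
  · filter_upwards [key] with x hx hxI
    linarith [hx hxI]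
  · have : IntegrableOn (fun _ : ℝ => c) I := by simp
    exact (show IntegrableOn (fun x => e x - c) I from he.sub this).locallyIntegrableOn
  · intro ψ hψ hψc hψs
    -- `ψ - m η` has vanishing integral, hence a compactly supported primitive, which is an
    -- admissible test function.
    set m := ∫ x, ψ x with hm
    set ζ : ℝ → ℝ := fun x => ψ x - m * η x with hζ
    have hζsm : ContDiff ℝ ∞ ζ := hψ.sub (contDiff_const.mul hηsm)
    set K := tsupport ψ ∪ tsupport η with hK
    have hKc : IsCompact K := hψc.isCompact.union hηcs.isCompact
    have hKI : K ⊆ I := union_subset hψs hηsupp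
    have hKne : K.Nonempty := by
      by_contra hne
      rw [not_nonempty_iff_eq_empty] at hne
      have : η = 0 := by
        rw [← tsupport_eq_empty_iff]
        exact (union_empty_iff.mp hne).2
      rw [this] at hηint
      simp at hηint
    obtain ⟨a, haK, ha⟩ := hKc.exists_isLeast hKne
    obtain ⟨b, hbK, hb⟩ := hKc.exists_isGreatest hKne
    have hζ0 : ∀ x, x ∉ K → ζ x = 0 := by
      intro x hx
      rw [hK, mem_union, not_or] at hx
      simp [hζ, image_eq_zero_of_notMem_tsupport hx.1, image_eq_zero_of_notMem_tsupport hx.2]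
    have hψi : Integrable ψ := hψ.continuous.integrable_of_hasCompactSupport hψc
    have hηi : Integrable η := hηsm.continuous.integrable_of_hasCompactSupport hηcs
    have hζtot : ∫ x, ζ x = 0 := by
      rw [hζ, integral_sub hψi (hηi.const_mul m), integral_const_mul, hηint, ← hm]; ring
    have hζi : Integrable ζ := hψi.sub (hηi.const_mul m)
    set φ : ℝ → ℝ := fun x => ∫ s in (-1:ℝ)..x, ζ s with hφ
    have hφd : ∀ x, HasDerivAt φ (ζ x) x := fun x =>
      intervalIntegral.integral_hasDerivAt_right (hζsm.continuous.intervalIntegrable _ _)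
        (hζsm.continuous.stronglyMeasurableAtFilter _ _) hζsm.continuous.continuousAt
    have hφ' : deriv φ = ζ := funext fun x => (hφd x).deriv
    have hφsm : ContDiff ℝ ∞ φ := by
      rw [contDiff_infty_iff_deriv, hφ']
      exact ⟨fun x => (hφd x).differentiableAt, hζsm⟩
    have hφt : tsupport φ ⊆ Icc a b := by
      refine closure_minimal ?_ isClosed_Icc
      intro x hx
      by_contra hxn
      refine hx ?_
      have ha' := (hKI haK).1
      have hb' := (hKI hbK).2
      rcases lt_or_ge x a with hxa | hxa
      · have : ∫ s in (-1:ℝ)..x, ζ s = ∫ s in (-1:ℝ)..x, (0:ℝ) := by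
          refine intervalIntegral.integral_congr fun s hs => hζ0 s fun hsK => ?_
          have := ha hsK
          have h2 := hs.2
          have : s < a := lt_of_le_of_lt h2 (max_lt ha' hxa)
          linarith
        simp [hφ, this]
      · have hxb : b < x := by
          by_contra! hh
          exact hxn ⟨hxa, hh⟩
        have : ∫ s in (-1:ℝ)..x, ζ s = ∫ s, ζ s := by
          refine intervalIntegral.integral_eq_integral_of_support_subset fun s hs => ?_
          have hsK : s ∈ K := by
            by_contra hh
            exact hs (hζ0 s hh)
          exact ⟨(hKI hsK).1, (hb hsK).trans hxb.le⟩
        show φ x = 0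
        rw [hφ]; simp only; rw [this, hζtot]
    have hIccI : Icc a b ⊆ I := Icc_subset_Ioo (hKI haK).1 (hKI hbK).2
    have h0 := h φ hφsm (isCompact_Icc.of_isClosed_subset (isClosed_tsupport φ) hφt)
      (hφt.trans hIccI)
    have h1 : ∫ x in I, e x * ψ x = m * c := by
      have hs : ∫ x in I, e x * ζ x = (∫ x in I, e x * ψ x) - m * c := by
        rw [hc, ← integral_const_mul, ← integral_sub (hmulint ψ hψ.continuous hψc)
          ((hmulint η hηsm.continuous hηcs).const_mul m)]
        congr 1; ext x; simp only [hζ]; ring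
      rw [hφ', hs] at h0
      linarith
    have hψI : ∀ x, x ∉ I → ψ x = 0 := fun x hx =>
      image_eq_zero_of_notMem_tsupport fun hh => hx (hψs hh)
    have h2 : ∫ x in I, ψ x = m := setIntegral_eq_integral_of_forall_compl_eq_zero hψI
    rw [← setIntegral_eq_integral_of_forall_compl_eq_zero (s := I)
      (fun x hx => by rw [hψI x hx, zero_smul])]
    have h3 : ∫ x in I, ψ x • (e x - c) = (∫ x in I, e x * ψ x) - c * ∫ x in I, ψ x := by
      rw [← integral_const_mul, ← integral_sub (hmulint ψ hψ.continuous hψc)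
        (hψi.integrableOn.const_mul c)]
      congr 1; ext x; simp only [smul_eq_mul]; ring
    rw [h3, h1, h2]; ring

theorem isPrimitiveOnI_integral {z : ℝ → ℝ} (hz : IntegrableOn z I) (C : ℝ) :
    IsPrimitiveOnI (fun x => (∫ s in (0:ℝ)..x, z s) + C) z := by
  intro x hx y hy
  have hi : ∀ a ∈ I, IntervalIntegrable z volume 0 a := fun a ha =>
    intervalIntegrable_iff.mpr (hz.mono_set (uIoc_subset_I zero_mem_I ha))
  have := intervalIntegral.integral_interval_sub_left (hi y hy) (hi x hx)
  simp only
  rw [← this]; ring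

/-- A function in `H¹(I)` agrees almost everywhere with a primitive of its weak derivative. -/
theorem HasH1Deriv.exists_isPrimitive {g : ℝ → ℝ} {z : L2I} (h : HasH1Deriv g z) :
    ∃ P : ℝ → ℝ, IsPrimitiveOnI P z ∧ ∀ᵐ x, x ∈ I → g x = P x := by
  have hz : IntegrableOn z I := integrableOn_I_of_memLp (Lp.memLp z)
  have hP0 := isPrimitiveOnI_integral hz 0
  have hi : IntervalIntegrable z volume (-1) 1 :=
    (intervalIntegrable_iff_integrableOn_Ioo_of_le (by norm_num)).mpr hz
  have hc := (hi.absolutelyContinuousOnInterval_intervalIntegral (c := 0)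
    (by rw [uIcc_of_le (by norm_num)]; constructor <;> norm_num)).continuousOn
  rw [uIcc_of_le (by norm_num)] at hc
  have hPi : IntegrableOn (fun x => ∫ s in (0:ℝ)..x, z s) I :=
    (hc.integrableOn_compact isCompact_Icc).mono_set Ioo_subset_Icc_self
  have hg : IntegrableOn g I := integrableOn_I_of_memLp h.1
  obtain ⟨c, hc'⟩ := ae_eq_const_of_integral_mul_deriv_eq_zero (hg.sub hPi) (by
    intro φ hφ hφc hφs
    obtain ⟨C, hC⟩ := hφc.deriv.exists_bound_of_continuous
      (hφ.continuous_deriv (by exact_mod_cast le_top))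
    have hmeas : AEStronglyMeasurable (deriv φ) volI :=
      (hφ.continuous_deriv (by exact_mod_cast le_top)).aestronglyMeasurable
    have e1 := h.2 φ hφ hφc hφs
    have e2 := integral_primitive_mul_deriv hz hφ hφs
    simp only [Pi.sub_apply, sub_mul]
    rw [integral_sub (hg.mul_bdd hmeas (ae_of_all _ hC)) (hPi.mul_bdd hmeas (ae_of_all _ hC)),
      e1, e2, sub_self])
  refine ⟨fun x => (∫ s in (0:ℝ)..x, z s) + c, isPrimitiveOnI_integral hz c, ?_⟩
  filter_upwards [hc'] with x hx hxI
  have := hx hxI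
  simp only [Pi.sub_apply] at this
  linarith

theorem rho_pos {ρ₀ x : ℝ} (h : 0 < ρ₀) (hx : x ∈ I) : 0 < rho ρ₀ x := by
  have : x ^ 2 < 1 := by nlinarith [hx.1, hx.2]
  exact mul_pos h (by linarith)

theorem continuous_rho (ρ₀ : ℝ) : Continuous (rho ρ₀) := by
  unfold rho; fun_prop

/-- `w` is continuously differentiable on `I`, its flux `ρ w_x` is `P`, and `P_x = z ∈ L²(I)`. -/
structure HasFlux (ρ₀ : ℝ) (w P z : ℝ → ℝ) : Prop where
  memLp : MemLp z 2 volI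
  hasDerivAt : ∀ x ∈ I, HasDerivAt w (P x / rho ρ₀ x) x
  isPrimitive : IsPrimitiveOnI P z

/-- Elements of `D(A)` are continuously differentiable in `I`. -/
theorem IsA.exists_hasFlux {ρ₀ : ℝ} (hρ : 0 < ρ₀) {w : ℝ → ℝ} {z : L2I} (h : IsA ρ₀ w z) :
    ∃ P, HasFlux ρ₀ w P z := by
  obtain ⟨P, hP, hae⟩ := h.2.exists_isPrimitive
  have hz : IntegrableOn z I := integrableOn_I_of_memLp (Lp.memLp z)
  have hcont : ContinuousOn (fun x => P x / rho ρ₀ x) I :=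
    (hP.continuousOn hz).div (continuous_rho ρ₀).continuousOn fun x hx => (rho_pos hρ hx).ne'
  refine ⟨P, Lp.memLp z, fun x hx => ?_, hP⟩
  have hw : ∀ y ∈ I, w y = w x + ∫ s in x..y, P s / rho ρ₀ s := by
    intro y hy
    have h1 := (h.1.locallyAC x hx y hy).integral_deriv_eq_sub
    have h2 : ∫ s in x..y, deriv w s = ∫ s in x..y, P s / rho ρ₀ s := by
      refine intervalIntegral.integral_congr_ae ?_
      filter_upwards [hae] with s hs hsm
      have hsI := uIoc_subset_I hx hy hsm
      rw [eq_div_iff (rho_pos hρ hsI).ne', ← hs hsI]; ring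
    rw [← h2, h1]; ring
  have hd : HasDerivAt (fun y => w x + ∫ s in x..y, P s / rho ρ₀ s) (P x / rho ρ₀ x) x := by
    refine (intervalIntegral.integral_hasDerivAt_right (by simp) ?_
      (hcont.continuousAt (isOpen_Ioo.mem_nhds hx))).const_add _
    exact hcont.stronglyMeasurableAtFilter isOpen_Ioo x hx
  refine hd.congr_of_eventuallyEq ?_
  filter_upwards [isOpen_Ioo.mem_nhds hx] with y hy using hw y hy

/-! ### The space `V`: pointwise bounds and continuity -/

theorem MemV.continuousOn {ρ₀ : ℝ} {w : ℝ → ℝ} (h : MemV ρ₀ w) : ContinuousOn w I := by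
  intro x hx
  obtain ⟨a, ha1, ha2⟩ := exists_between hx.1
  obtain ⟨b, hb1, hb2⟩ := exists_between hx.2
  have hc := (h.locallyAC a ⟨ha1, ha2.trans hx.2⟩ b ⟨hx.1.trans hb1, hb2⟩).continuousOn
  rw [uIcc_of_le (ha2.trans hb1).le] at hc
  exact (hc.continuousAt (Icc_mem_nhds ha2 hb1)).continuousWithinAt

theorem MemV.ae_differentiableAt {ρ₀ : ℝ} {w : ℝ → ℝ} (h : MemV ρ₀ w) :
    ∀ᵐ x, x ∈ I → DifferentiableAt ℝ w x := by
  have hn : ∀ n : ℕ, (1 : ℝ) / (n + 2) ≤ 1 / 2 := fun n => by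
    apply one_div_le_one_div_of_le <;> linarith [(Nat.cast_nonneg n : (0:ℝ) ≤ n)]
  have hp : ∀ n : ℕ, 0 < (1 : ℝ) / (n + 2) := fun n => by positivity
  have hall : ∀ᵐ x, ∀ n : ℕ, x ∈ uIcc (-1 + 1 / (n + 2 : ℝ)) (1 - 1 / (n + 2 : ℝ)) →
      DifferentiableAt ℝ w x := by
    rw [ae_all_iff]
    intro n
    have := hn n
    have := hp n
    exact (h.locallyAC _ ⟨by linarith, by linarith⟩ _ ⟨by linarith, by linarith⟩).ae_differentiableAt
  filter_upwards [hall] with x hx hxI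
  have hd : 0 < min (x + 1) (1 - x) := lt_min (by linarith [hxI.1]) (by linarith [hxI.2])
  obtain ⟨n, hn'⟩ := exists_nat_one_div_lt hd
  refine hx n ?_
  have h1 : (1 : ℝ) / (n + 2) ≤ 1 / (n + 1) := by
    apply one_div_le_one_div_of_le <;> linarith [(Nat.cast_nonneg n : (0:ℝ) ≤ n)]
  have h2 := min_le_left (x + 1) (1 - x)
  have h3 := min_le_right (x + 1) (1 - x)
  rw [uIcc_of_le (by linarith [hn n])]
  constructor <;> linarith

theorem MemV.sub {ρ₀ : ℝ} {v w : ℝ → ℝ} (hv : MemV ρ₀ v) (hw : MemV ρ₀ w) :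
    MemV ρ₀ (fun x => v x - w x) := by
  refine ⟨hv.memLp.sub hw.memLp, fun a ha b hb => (hv.locallyAC a ha b hb).fun_sub
    (hw.locallyAC a ha b hb), (hv.memLp_deriv.sub hw.memLp_deriv).ae_eq ?_⟩
  rw [EventuallyEq, ae_restrict_iff' measurableSet_Ioo]
  filter_upwards [hv.ae_differentiableAt, hw.ae_differentiableAt] with x h1 h2 hx
  rw [Pi.sub_apply, deriv_fun_sub (h1 hx) (h2 hx)]; ring

theorem integral_sq_le_of_eLpNorm_le {g : ℝ → ℝ} {N : ℝ} (hg : MemLp g 2 volI) (hN : 0 ≤ N)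
    (h : eLpNorm g 2 volI ≤ ENNReal.ofReal N) : ∫ x in I, g x ^ 2 ≤ N ^ 2 := by
  rw [hg.eLpNorm_eq_integral_rpow_norm (by norm_num) (by norm_num),
    ENNReal.ofReal_le_ofReal_iff hN] at h
  simp only [ENNReal.toReal_ofNat, Real.rpow_ofNat, Real.norm_eq_abs, sq_abs] at h
  have hnn : 0 ≤ ∫ x in I, g x ^ 2 := integral_nonneg fun x => sq_nonneg _
  rw [show ((2:ℝ)⁻¹) = 1 / 2 by norm_num, ← Real.sqrt_eq_rpow] at h
  exact (Real.sqrt_le_left hN).mp h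

/-- The weight `(1 - x²)^{-1/16}`: it dominates elements of `V` pointwise, and its eighth power is
still integrable on `I`. -/
noncomputable def ell (x : ℝ) : ℝ := (1 - x ^ 2) ^ (-(1 / 16) : ℝ)

theorem one_sub_sq_pos {x : ℝ} (hx : x ∈ I) : 0 < 1 - x ^ 2 := by nlinarith [hx.1, hx.2]

theorem one_le_ell {x : ℝ} (hx : x ∈ I) : 1 ≤ ell x :=
  Real.one_le_rpow_of_pos_of_le_one_of_nonpos (one_sub_sq_pos hx) (by nlinarith [sq_nonneg x])
    (by norm_num)

theorem continuousOn_ell : ContinuousOn ell I := by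
  unfold ell
  exact ContinuousOn.rpow_const (by fun_prop) fun x hx => Or.inl (one_sub_sq_pos hx).ne'

theorem memLp_ell_pow : MemLp (fun x => ell x ^ 4) 2 volI := by
  have hm : AEStronglyMeasurable (fun x => ell x ^ 4) volI :=
    (continuousOn_ell.pow 4).aestronglyMeasurable measurableSet_Ioo
  rw [memLp_two_iff_integrable_sq hm]
  have h : IntegrableOn (fun x => 1 / √(1 - x ^ 2)) (Ioo (-1) 1) := by
    have := intervalIntegral.integrableOn_deriv_of_nonneg (a := -1) (b := 1) (g := Real.arcsin)
      (g' := fun x => 1 / √(1 - x ^ 2)) Real.continuous_arcsin.continuousOn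
      (fun x hx => Real.hasDerivAt_arcsin hx.1.ne' hx.2.ne) (fun x hx => by positivity)
    exact this.mono_set Ioo_subset_Ioc_self
  refine Integrable.congr h ?_
  rw [EventuallyEq, ae_restrict_iff' measurableSet_Ioo]
  refine ae_of_all _ fun x hx => ?_
  have hp := one_sub_sq_pos hx
  simp only [ell]
  rw [← pow_mul, ← Real.rpow_mul_natCast hp.le, Real.sqrt_eq_rpow, one_div,
    ← Real.rpow_neg hp.le]
  norm_num

/-- A primitive of `2 / (1 - x²)`. -/
noncomputable def logRatio (x : ℝ) : ℝ := Real.log (1 + x) - Real.log (1 - x)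

theorem hasDerivAt_logRatio {x : ℝ} (hx : x ∈ I) :
    HasDerivAt logRatio (2 / (1 - x ^ 2)) x := by
  have h1 : 0 < 1 + x := by linarith [hx.1]
  have h2 : 0 < 1 - x := by linarith [hx.2]
  have := (((hasDerivAt_id x).const_add 1).log h1.ne').sub
    (((hasDerivAt_id x).const_sub 1).log h2.ne')
  refine this.congr_deriv ?_
  have : (1 - x ^ 2) = (1 + x) * (1 - x) := by ring
  rw [this]
  simp only [id]
  field_simp
  ring

theorem abs_logRatio_le {x : ℝ} (hx : x ∈ I) : |logRatio x| ≤ 20 * ell x := by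
  have h1 : 0 < 1 + x := by linarith [hx.1]
  have h2 : 0 < 1 - x := by linarith [hx.2]
  have hp := one_sub_sq_pos hx
  have hfac : (1 - x ^ 2) = (1 + x) * (1 - x) := by ring
  have hlog : Real.log (1 - x ^ 2) = Real.log (1 + x) + Real.log (1 - x) := by
    rw [hfac, Real.log_mul h1.ne' h2.ne']
  have hb : -Real.log (1 - x ^ 2) ≤ 16 * ell x := by
    have := Real.log_le_rpow_div (x := (1 - x ^ 2)⁻¹) (by positivity) (ε := 1 / 16) (by norm_num)
    rw [Real.log_inv, Real.inv_rpow hp.le, ← Real.rpow_neg hp.le] at this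
    unfold ell
    linarith
  have e1 := Real.log_le_sub_one_of_pos h1
  have e2 := Real.log_le_sub_one_of_pos h2
  have := one_le_ell hx
  unfold logRatio
  rw [abs_le]
  constructor <;> linarith [hx.1, hx.2]

/-- The embedding of `V` into a weighted space of continuous functions: `∫ 1/ρ` grows only
logarithmically at `±1`, and a logarithm is dominated by any negative power of `1 - x²`. -/
theorem exists_abs_le_ell {ρ₀ : ℝ} (hρ : 0 < ρ₀) : ∃ C : ℝ, 0 < C ∧ ∀ w : ℝ → ℝ, MemV ρ₀ w →
    ∀ N : ℝ, 0 < N → normV ρ₀ w ≤ ENNReal.ofReal N → ∀ x ∈ I, |w x| ≤ C * N * ell x := by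
  refine ⟨2 + (1 + 20 / ρ₀), by positivity, fun w hw N hN hle x hx => ?_⟩
  have hL1 : ∫ x in I, w x ^ 2 ≤ N ^ 2 :=
    integral_sq_le_of_eLpNorm_le hw.memLp hN.le (le_self_add.trans hle)
  have hL2 : ∫ x in I, (√(rho ρ₀ x) * deriv w x) ^ 2 ≤ N ^ 2 :=
    integral_sq_le_of_eLpNorm_le hw.memLp_deriv hN.le (le_add_self.trans hle)
  -- On an interval of length `1` some value of `w` is controlled by the `L²` norm.
  obtain ⟨y, hy, hwy⟩ : ∃ y ∈ Ioo (-1/2 : ℝ) (1/2), |w y| ≤ 2 * N := by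
    by_contra! hc
    have hJ : Ioo (-1/2 : ℝ) (1/2) ⊆ I := Ioo_subset_Ioo (by norm_num) (by norm_num)
    have hsq : IntegrableOn (fun x => w x ^ 2) I := hw.memLp.integrable_sq
    have e1 : ∫ x in Ioo (-1/2 : ℝ) (1/2), (2 * N) ^ 2 ≤ ∫ x in Ioo (-1/2 : ℝ) (1/2), w x ^ 2 := by
      refine setIntegral_mono_on (integrableOn_const (by simp)) (hsq.mono_set hJ) measurableSet_Ioo fun s hs => ?_
      rw [← sq_abs (w s)]
      have := hc s hs
      gcongr
    have e2 : ∫ x in Ioo (-1/2 : ℝ) (1/2), w x ^ 2 ≤ ∫ x in I, w x ^ 2 :=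
      setIntegral_mono_set hsq (ae_of_all _ fun x => sq_nonneg _) hJ.eventuallyLE
    have e3 : ∫ x in Ioo (-1/2 : ℝ) (1/2), (2 * N) ^ 2 = (2 * N) ^ 2 := by
      rw [setIntegral_const, Measure.real, Real.volume_Ioo]; norm_num
    nlinarith
  have hyI : y ∈ I := ⟨by linarith [hy.1], by linarith [hy.2]⟩
  have hlx := abs_logRatio_le hx
  have hly : |logRatio y| ≤ 20 := by
    have h1 : 0 < 1 + y := by linarith [hyI.1]
    have h2 : 0 < 1 - y := by linarith [hyI.2]
    have a1 := Real.log_le_sub_one_of_pos h1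
    have a2 := Real.log_le_sub_one_of_pos h2
    have b1 := Real.one_sub_inv_le_log_of_pos h1
    have b2 := Real.one_sub_inv_le_log_of_pos h2
    have c1 : (1 + y)⁻¹ ≤ 2 := by
      rw [show (2:ℝ) = (1/2)⁻¹ by norm_num]
      exact inv_anti₀ (by norm_num) (by linarith [hy.1])
    have c2 : (1 - y)⁻¹ ≤ 2 := by
      rw [show (2:ℝ) = (1/2)⁻¹ by norm_num]
      exact inv_anti₀ (by norm_num) (by linarith [hy.2])
    unfold logRatio
    rw [abs_le]
    constructor <;> linarith [hyI.1, hyI.2]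
  have hsub := uIoc_subset_I hyI hx
  have hftc := (hw.locallyAC y hyI x hx).integral_deriv_eq_sub
  have hdi := (hw.locallyAC y hyI x hx).intervalIntegrable_deriv
  have hρi : ContinuousOn (fun s => N / (2 * rho ρ₀ s)) I :=
    continuousOn_const.div ((continuous_rho ρ₀).const_mul 2).continuousOn
      fun s hs => by have := rho_pos hρ hs; positivity
  have hρint : IntervalIntegrable (fun s => N / (2 * rho ρ₀ s)) volume y x :=
    (hρi.mono (uIcc_subset_I hyI hx)).intervalIntegrable
  have hsqI : IntegrableOn (fun s => (√(rho ρ₀ s) * deriv w s) ^ 2) I :=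
    hw.memLp_deriv.integrable_sq
  have hA : ∫ s in uIoc y x, N / (2 * rho ρ₀ s) ≤ N / (4 * ρ₀) * (20 * ell x + 20) := by
    have hval : ∫ s in y..x, N / (2 * rho ρ₀ s)
        = N / (4 * ρ₀) * logRatio x - N / (4 * ρ₀) * logRatio y := by
      refine intervalIntegral.integral_eq_sub_of_hasDerivAt
        (f := fun s => N / (4 * ρ₀) * logRatio s) (fun s hs => ?_) hρint
      have hsI := uIcc_subset_I hyI hx hs
      refine ((hasDerivAt_logRatio hsI).const_mul _).congr_deriv ?_
      have := one_sub_sq_pos hsI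
      unfold rho
      field_simp
      norm_num
    have habs : |∫ s in y..x, N / (2 * rho ρ₀ s)| = ∫ s in uIoc y x, N / (2 * rho ρ₀ s) := by
      rw [intervalIntegral.abs_integral_eq_abs_integral_uIoc, abs_of_nonneg]
      refine setIntegral_nonneg measurableSet_uIoc fun s hs => ?_
      have := rho_pos hρ (hsub hs)
      positivity
    rw [← habs, hval, ← mul_sub, abs_mul, abs_of_pos (by positivity)]
    gcongr
    exact (abs_sub _ _).trans (add_le_add hlx hly)
  have hB : ∫ s in uIoc y x, (√(rho ρ₀ s) * deriv w s) ^ 2 / (2 * N) ≤ N / 2 := by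
    rw [integral_div, div_le_iff₀ (by positivity)]
    have : ∫ s in uIoc y x, (√(rho ρ₀ s) * deriv w s) ^ 2
        ≤ ∫ s in I, (√(rho ρ₀ s) * deriv w s) ^ 2 :=
      setIntegral_mono_set hsqI (ae_of_all _ fun x => sq_nonneg _) hsub.eventuallyLE
    nlinarith
  have hmain : |w x - w y| ≤ N / (4 * ρ₀) * (20 * ell x + 20) + N / 2 := by
    rw [← hftc, ← Real.norm_eq_abs]
    refine (intervalIntegral.norm_integral_le_integral_norm_uIoc).trans ?_
    -- Young's inequality, with the weight `N` so that the resulting bound is linear in `N`.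
    have hle2 : ∫ s in uIoc y x, ‖deriv w s‖ ≤ ∫ s in uIoc y x,
        (N / (2 * rho ρ₀ s) + (√(rho ρ₀ s) * deriv w s) ^ 2 / (2 * N)) := by
      refine setIntegral_mono_on (intervalIntegrable_iff.mp hdi).norm
        ((intervalIntegrable_iff.mp hρint).add ((hsqI.mono_set hsub).div_const _))
        measurableSet_uIoc fun s hs => ?_
      have hr := rho_pos hρ (hsub hs)
      rw [mul_pow, Real.sq_sqrt hr.le, Real.norm_eq_abs, ← sq_abs (deriv w s),
        div_add_div _ _ (by positivity) (by positivity), le_div_iff₀ (by positivity)]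
      nlinarith [sq_nonneg (N - rho ρ₀ s * |deriv w s|)]
    rw [integral_add (intervalIntegrable_iff.mp hρint) ((hsqI.mono_set hsub).div_const _)] at hle2
    linarith
  have h1 := one_le_ell hx
  have htri : |w x| ≤ |w x - w y| + |w y| := by
    have := abs_add_le (w x - w y) (w y); rwa [sub_add_cancel] at this
  have hq : N / (4 * ρ₀) * (20 * ell x + 20) ≤ 20 / ρ₀ * N * ell x := by
    rw [div_mul_eq_mul_div, div_le_iff₀ (by positivity)]
    have : 20 / ρ₀ * N * ell x * (4 * ρ₀) = 80 * N * ell x := by field_simp; norm_num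
    rw [this]
    nlinarith
  nlinarith [mul_le_mul_of_nonneg_left h1 hN.le]

theorem ContinuousIntoV.eventually_abs_sub_le {ρ₀ a b : ℝ} (hρ : 0 < ρ₀) {u : ℝ → ℝ → ℝ}
    (hu : ContinuousIntoV ρ₀ a b u) {t : ℝ} (ht : t ∈ Icc a b) {η : ℝ} (hη : 0 < η) :
    ∀ᶠ s in 𝓝[Icc a b] t, ∀ x ∈ I, |u s x - u t x| ≤ η * ell x := by
  obtain ⟨C, hC, h⟩ := exists_abs_le_ell hρ
  have hev := (hu.2 t ht).eventually_le_const (u := ENNReal.ofReal (η / C))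
    (ENNReal.ofReal_pos.mpr (by positivity))
  filter_upwards [hev, self_mem_nhdsWithin] with s hs hsm x hx
  have := h _ ((hu.1 s hsm).sub (hu.1 t ht)) (η / C) (by positivity) hs x hx
  rwa [mul_div_cancel₀ _ hC.ne'] at this

theorem MemV.exists_abs_le_ell {ρ₀ : ℝ} (hρ : 0 < ρ₀) {w : ℝ → ℝ} (hw : MemV ρ₀ w) :
    ∃ C : ℝ, 0 ≤ C ∧ ∀ x ∈ I, |w x| ≤ C * ell x := by
  obtain ⟨C, hC, h⟩ := EBM.exists_abs_le_ell hρ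
  have hfin : normV ρ₀ w ≠ ⊤ :=
    ENNReal.add_ne_top.mpr ⟨hw.memLp.2.ne, hw.memLp_deriv.2.ne⟩
  refine ⟨C * ((normV ρ₀ w).toReal + 1), by positivity, h w hw _ (by positivity) ?_⟩
  rw [← ENNReal.ofReal_toReal hfin]
  exact ENNReal.ofReal_le_ofReal (by simp)

theorem ContinuousIntoV.exists_abs_le {ρ₀ a b : ℝ} (hρ : 0 < ρ₀) {u : ℝ → ℝ → ℝ}
    (hu : ContinuousIntoV ρ₀ a b u) :
    ∃ C : ℝ, 0 ≤ C ∧ ∀ t ∈ Icc a b, ∀ x ∈ I, |u t x| ≤ C * ell x := by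
  refine isCompact_Icc.induction_on (s := Icc a b)
    (p := fun s => ∃ C : ℝ, 0 ≤ C ∧ ∀ t ∈ s, ∀ x ∈ I, |u t x| ≤ C * ell x) ?_ ?_ ?_ ?_
  · exact ⟨0, le_rfl, by simp⟩
  · rintro s t hst ⟨C, hC, h⟩
    exact ⟨C, hC, fun r hr => h r (hst hr)⟩
  · rintro s t ⟨C, hC, h⟩ ⟨D, hD, h'⟩
    refine ⟨max C D, le_max_of_le_left hC, ?_⟩
    rintro r (hr | hr) x hx
    · exact (h r hr x hx).trans (mul_le_mul_of_nonneg_right (le_max_left _ _)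
        (zero_le_one.trans (one_le_ell hx)))
    · exact (h' r hr x hx).trans (mul_le_mul_of_nonneg_right (le_max_right _ _)
        (zero_le_one.trans (one_le_ell hx)))
  · intro t ht
    obtain ⟨C, hC, h⟩ := (hu.1 t ht).exists_abs_le_ell hρ
    refine ⟨_, hu.eventually_abs_sub_le hρ ht one_pos, C + 1, by positivity, fun s hs x hx => ?_⟩
    have h1 := hs x hx
    have h2 := h x hx
    have h3 := abs_add_le (u s x - u t x) (u t x)
    rw [sub_add_cancel] at h3
    linarith

theorem ContinuousIntoV.continuousOn_uncurry {ρ₀ a b : ℝ} (hρ : 0 < ρ₀) {u : ℝ → ℝ → ℝ}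
    (hu : ContinuousIntoV ρ₀ a b u) :
    ContinuousOn (Function.uncurry u) (Icc a b ×ˢ I) := by
  rintro ⟨t, x⟩ ⟨ht, hx⟩
  have hell : ContinuousWithinAt (fun p : ℝ × ℝ => ell p.2) (Icc a b ×ˢ I) (t, x) :=
    ContinuousWithinAt.comp (g := ell) (t := I) (x := (t, x)) (f := Prod.snd)
      (continuousOn_ell x hx) continuousWithinAt_snd fun p hp => hp.2
  have hux : ContinuousWithinAt (fun p : ℝ × ℝ => u t p.2) (Icc a b ×ˢ I) (t, x) :=
    ContinuousWithinAt.comp (g := u t) (t := I) (x := (t, x)) (f := Prod.snd)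
      ((hu.1 t ht).continuousOn x hx) continuousWithinAt_snd fun p hp => hp.2
  rw [ContinuousWithinAt, Metric.tendsto_nhds]
  intro η hη
  have hpos : 0 < ell x + 1 := by linarith [one_le_ell hx]
  have h1 := hell.eventually_lt_const (u := ell x + 1) (by simp)
  have h2 := (Metric.tendsto_nhds.mp hux) (η / 2) (by positivity)
  have h3 : ∀ᶠ p : ℝ × ℝ in 𝓝[Icc a b ×ˢ I] (t, x), ∀ y ∈ I,
      |u p.1 y - u t y| ≤ η / (2 * (ell x + 1)) * ell y := by
    have : Tendsto Prod.fst (𝓝[Icc a b ×ˢ I] (t, x)) (𝓝[Icc a b] t) :=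
      continuousWithinAt_fst.tendsto_nhdsWithin fun p hp => hp.1
    exact this.eventually (hu.eventually_abs_sub_le hρ ht (by positivity))
  filter_upwards [h1, h2, h3, self_mem_nhdsWithin] with p q1 q2 q3 q4
  have q5 := q3 p.2 q4.2
  rw [Real.dist_eq] at q2 ⊢
  have q6 : η / (2 * (ell x + 1)) * ell p.2 < η / 2 := by
    calc _ < η / (2 * (ell x + 1)) * (ell x + 1) := by gcongr
      _ = η / 2 := by field_simp
  have q7 := abs_add_le (u p.1 p.2 - u t p.2) (u t p.2 - u t x)
  rw [sub_add_sub_cancel] at q7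
  change |u p.1 p.2 - u t x| < η
  linarith

/-! ### Mild solutions and the semigroup -/

theorem IsExpA.exists_norm_le {ρ₀ : ℝ} {S : ℝ → L2I →L[ℝ] L2I} (hS : IsExpA ρ₀ S) (T : ℝ) :
    ∃ M : ℝ, 0 ≤ M ∧ ∀ t ∈ Icc 0 T, ‖S t‖ ≤ M := by
  obtain ⟨C, hC⟩ := banach_steinhaus (g := fun t : Icc (0:ℝ) T => S t) fun x => by
    obtain ⟨C, hC⟩ := isCompact_Icc.exists_bound_of_continuousOn
      ((hS.continuousOn x).mono (Icc_subset_Ici_self : Icc 0 T ⊆ Ici 0))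
    exact ⟨C, fun i => hC i i.2⟩
  exact ⟨max C 0, le_max_right _ _, fun t ht => (hC ⟨t, ht⟩).trans (le_max_left _ _)⟩

theorem IsExpA.continuousOn_apply {ρ₀ : ℝ} {S : ℝ → L2I →L[ℝ] L2I} (hS : IsExpA ρ₀ S) {T t : ℝ}
    (ht : t ≤ T) {G : ℝ → L2I} (hG : ContinuousOn G (Icc 0 T)) :
    ContinuousOn (fun s => S (t - s) (G s)) (Icc 0 t) := by
  obtain ⟨M, hM0, hM⟩ := hS.exists_norm_le t
  intro s hs
  have h1 : ContinuousWithinAt (fun r => S (t - r) (G s)) (Icc 0 t) s :=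
    ContinuousWithinAt.comp (g := fun σ => S σ (G s)) (t := Ici 0) (f := fun r => t - r)
      (hS.continuousOn (G s) (t - s) (sub_nonneg.mpr hs.2)) (by fun_prop)
      fun r hr => sub_nonneg.mpr hr.2
  have h2 : ContinuousWithinAt (fun r => S (t - r) (G r - G s)) (Icc 0 t) s := by
    have hGs : ContinuousWithinAt (fun r => G r - G s) (Icc 0 t) s :=
      ((hG s ⟨hs.1, hs.2.trans ht⟩).mono (Icc_subset_Icc_right ht)).sub continuousWithinAt_const
    rw [ContinuousWithinAt] at hGs ⊢
    rw [sub_self] at hGs ⊢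
    rw [map_zero]
    refine squeeze_zero_norm' (a := fun r => M * ‖G r - G s‖) ?_ ?_
    · filter_upwards [self_mem_nhdsWithin] with r hr
      refine (ContinuousLinearMap.le_opNorm _ _).trans ?_
      gcongr
      exact hM _ ⟨by linarith [hr.2], by linarith [hr.1]⟩
    · simpa using hGs.norm.const_mul M
  refine (h1.add h2).congr (fun r _ => ?_) ?_ <;> simp

/-- Restarting a mild solution at time `t`. -/
theorem IsExpA.duhamel_restart {ρ₀ : ℝ} {S : ℝ → L2I →L[ℝ] L2I} (hS : IsExpA ρ₀ S) {T : ℝ}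
    {G U : ℝ → L2I} {v : L2I} (hG : ContinuousOn G (Icc 0 T))
    (hU : ∀ t ∈ Icc 0 T, U t = S t v + ∫ s in (0:ℝ)..t, S (t - s) (G s)) {t h : ℝ} (ht : 0 ≤ t)
    (hh : 0 ≤ h) (hth : t + h ≤ T) :
    U (t + h) = S h (U t) + ∫ s in t..(t + h), S (t + h - s) (G s) := by
  have hc1 := hS.continuousOn_apply hth hG
  have hc0 := hS.continuousOn_apply (by linarith : t ≤ T) hG
  have hi0 : IntervalIntegrable (fun s => S (t - s) (G s)) volume 0 t :=
    (hc0.mono (by rw [uIcc_of_le ht])).intervalIntegrable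
  have hi1 : IntervalIntegrable (fun s => S (t + h - s) (G s)) volume 0 t :=
    (hc1.mono (by rw [uIcc_of_le ht]; exact Icc_subset_Icc_right (by linarith))).intervalIntegrable
  have hi2 : IntervalIntegrable (fun s => S (t + h - s) (G s)) volume t (t + h) :=
    (hc1.mono (by
      rw [uIcc_of_le (by linarith)]; exact Icc_subset_Icc_left ht)).intervalIntegrable
  rw [hU (t + h) ⟨by linarith, hth⟩, hU t ⟨ht, by linarith⟩, map_add,
    ← intervalIntegral.integral_add_adjacent_intervals hi1 hi2,
    ← (S h).intervalIntegral_comp_comm hi0, add_comm t h, hS.add h hh t ht]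
  have : ∫ s in (0:ℝ)..t, S (h + t - s) (G s) = ∫ s in (0:ℝ)..t, S h (S (t - s) (G s)) := by
    refine intervalIntegral.integral_congr fun s hs => ?_
    rw [uIcc_of_le ht] at hs
    rw [add_sub_assoc, hS.add h hh (t - s) (sub_nonneg.mpr hs.2)]
    rfl
  rw [this, ContinuousLinearMap.comp_apply, add_assoc]

/-- A mild solution with continuous right-hand side satisfies the equation at every time at which it
lies in the domain of the generator. -/
theorem IsExpA.tendsto_slope {ρ₀ : ℝ} {S : ℝ → L2I →L[ℝ] L2I} (hS : IsExpA ρ₀ S) {T : ℝ}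
    {G U : ℝ → L2I} {v z : L2I} (hG : ContinuousOn G (Icc 0 T))
    (hU : ∀ t ∈ Icc 0 T, U t = S t v + ∫ s in (0:ℝ)..t, S (t - s) (G s)) {t : ℝ}
    (ht : t ∈ Ioo 0 T)
    (hz : Tendsto (fun h : ℝ => h⁻¹ • (S h (U t) - U t)) (𝓝[>] 0) (𝓝 z)) :
    Tendsto (fun h : ℝ => h⁻¹ • (U (t + h) - U t)) (𝓝[>] 0) (𝓝 (z + G t)) := by
  obtain ⟨M, hM0, hM⟩ := hS.exists_norm_le T
  -- The integrand is within `η / 2` of `G t` on short intervals.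
  have hmain : Tendsto (fun h : ℝ => h⁻¹ • ∫ s in t..(t + h), S (t + h - s) (G s)) (𝓝[>] 0)
      (𝓝 (G t)) := by
    rw [Metric.tendsto_nhds]
    intro η hη
    have e1 : ∀ᶠ σ in 𝓝[≥] (0:ℝ), ‖S σ (G t) - G t‖ < η / 4 := by
      have := hS.continuousOn (G t) 0 self_mem_Ici
      rw [ContinuousWithinAt, hS.zero, Metric.tendsto_nhds] at this
      simpa [dist_eq_norm] using this (η / 4) (by positivity)
    have e2 : ∀ᶠ s in 𝓝 t, ‖G s - G t‖ < η / (4 * (M + 1)) := by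
      have := (hG.continuousAt (Icc_mem_nhds ht.1 ht.2))
      rw [ContinuousAt, Metric.tendsto_nhds] at this
      simpa [dist_eq_norm] using this (η / (4 * (M + 1))) (by positivity)
    obtain ⟨d1, hd1, H1⟩ := Metric.mem_nhdsWithin_iff.mp e1
    obtain ⟨d2, hd2, H2⟩ := Metric.mem_nhds_iff.mp e2
    have hd : 0 < min (min d1 d2) (T - t) := lt_min (lt_min hd1 hd2) (by linarith [ht.2])
    filter_upwards [Ioo_mem_nhdsGT hd] with h hh
    have hhd1 : h < d1 := hh.2.trans_le ((min_le_left _ _).trans (min_le_left _ _))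
    have hhd2 : h < d2 := hh.2.trans_le ((min_le_left _ _).trans (min_le_right _ _))
    have hhT : h < T - t := hh.2.trans_le (min_le_right _ _)
    have hc1 := hS.continuousOn_apply (by linarith : t + h ≤ T) hG
    have hi2 : IntervalIntegrable (fun s => S (t + h - s) (G s)) volume t (t + h) :=
      (hc1.mono (by
        rw [uIcc_of_le (by linarith [hh.1])]
        exact Icc_subset_Icc_left ht.1.le)).intervalIntegrable
    have hG' : G t = h⁻¹ • ∫ s in t..(t + h), G t := by
      rw [intervalIntegral.integral_const, add_sub_cancel_left, smul_smul,
        inv_mul_cancel₀ hh.1.ne', one_smul]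
    have hdiff : h⁻¹ • (∫ s in t..(t + h), S (t + h - s) (G s)) - G t
        = h⁻¹ • (∫ s in t..(t + h), S (t + h - s) (G s)) - h⁻¹ • ∫ s in t..(t + h), G t := by
      rw [← hG']
    rw [dist_eq_norm, hdiff, ← smul_sub, ← intervalIntegral.integral_sub hi2 (by simp), norm_smul,
      Real.norm_of_nonneg (inv_nonneg.mpr hh.1.le)]
    have hbd : ‖∫ s in t..(t + h), (S (t + h - s) (G s) - G t)‖ ≤ η / 2 * |t + h - t| := by
      refine intervalIntegral.norm_integral_le_of_norm_le_const fun s hs => ?_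
      rw [uIoc_of_le (by linarith [hh.1])] at hs
      have a1 : ‖S (t + h - s) (G t) - G t‖ < η / 4 := by
        refine H1 ⟨?_, sub_nonneg.mpr hs.2⟩
        rw [Metric.mem_ball, Real.dist_eq, sub_zero, abs_of_nonneg (sub_nonneg.mpr hs.2)]
        linarith [hs.1]
      have a2 : ‖G s - G t‖ < η / (4 * (M + 1)) := by
        refine H2 ?_
        rw [Metric.mem_ball, Real.dist_eq, abs_of_pos (by linarith [hs.1])]
        linarith [hs.2]
      have a3 : ‖S (t + h - s) (G s - G t)‖ ≤ M * (η / (4 * (M + 1))) := by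
        refine (ContinuousLinearMap.le_opNorm _ _).trans ?_
        gcongr
        exact hM _ ⟨by linarith [hs.2], by linarith [hs.1, ht.1]⟩
      have a4 : M * (η / (4 * (M + 1))) ≤ η / 4 := by
        rw [mul_div_assoc', div_le_div_iff₀ (by positivity) (by positivity)]
        nlinarith
      have a5 : S (t + h - s) (G s) - G t
          = S (t + h - s) (G s - G t) + (S (t + h - s) (G t) - G t) := by
        rw [map_sub]; abel
      rw [a5]
      refine (norm_add_le _ _).trans ?_
      linarith
    rw [add_sub_cancel_left, abs_of_pos hh.1] at hbd
    calc h⁻¹ * ‖∫ s in t..(t + h), (S (t + h - s) (G s) - G t)‖ ≤ h⁻¹ * (η / 2 * h) := by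
          gcongr
          exact inv_nonneg.mpr hh.1.le
      _ = η / 2 := by have := hh.1.ne'; field_simp
      _ < η := by linarith
  refine (hz.add hmain).congr' ?_
  filter_upwards [Ioo_mem_nhdsGT (show (0:ℝ) < T - t by linarith [ht.2])] with h hh
  rw [hS.duhamel_restart hG hU ht.1.le hh.1.le (by linarith [hh.2]), ← smul_add]
  congr 1; abel

/-! ### Classes in `L²(I)` -/

theorem toL2_eq {w : ℝ → ℝ} (h : MemLp w 2 volI) : toL2 w = h.toLp w := by
  rw [toL2, dif_pos h]

theorem coeFn_toL2 {w : ℝ → ℝ} (h : MemLp w 2 volI) : toL2 w =ᵐ[volI] w := by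
  rw [toL2_eq h]; exact h.coeFn_toLp

theorem toL2_sub {v w : ℝ → ℝ} (hv : MemLp v 2 volI) (hw : MemLp w 2 volI) :
    toL2 (fun x => v x - w x) = toL2 v - toL2 w := by
  rw [toL2_eq hv, toL2_eq hw, ← MemLp.toLp_sub]
  exact toL2_eq (hv.sub hw)

theorem toL2_const_mul {w : ℝ → ℝ} (c : ℝ) (hw : MemLp w 2 volI) :
    toL2 (fun x => c * w x) = c • toL2 w := by
  rw [toL2_eq hw, ← MemLp.toLp_const_smul]
  exact toL2_eq (hw.const_mul c)

theorem norm_toL2_sq {w : ℝ → ℝ} (hw : MemLp w 2 volI) : ‖toL2 w‖ ^ 2 = ∫ x in I, w x ^ 2 := by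
  rw [← real_inner_self_eq_norm_sq, L2.inner_def]
  refine integral_congr_ae ?_
  filter_upwards [coeFn_toL2 hw] with x hx
  rw [hx]; simp [sq]

/-- Dominated convergence for paths in `L²(I)`. -/
theorem continuousOn_toL2 {F : ℝ → ℝ → ℝ} {B : ℝ → ℝ} {J : Set ℝ}
    (hF : ContinuousOn (Function.uncurry F) (J ×ˢ I)) (hB : MemLp B 2 volI)
    (hFB : ∀ t ∈ J, ∀ x ∈ I, |F t x| ≤ B x) :
    (∀ t ∈ J, MemLp (F t) 2 volI) ∧ ContinuousOn (fun t => toL2 (F t)) J := by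
  have hFx : ∀ t ∈ J, ContinuousOn (F t) I := fun t ht =>
    hF.comp (f := fun x => (t, x)) (by fun_prop) fun x hx => ⟨ht, hx⟩
  have hmem : ∀ t ∈ J, MemLp (F t) 2 volI := fun t ht =>
    hB.of_le ((hFx t ht).aestronglyMeasurable measurableSet_Ioo) (by
      rw [ae_restrict_iff' measurableSet_Ioo]
      exact ae_of_all _ fun x hx => (hFB t ht x hx).trans (le_abs_self _))
  refine ⟨hmem, fun t ht => ?_⟩
  rw [ContinuousWithinAt, tendsto_iff_norm_sub_tendsto_zero]
  have hsq : Tendsto (fun s => ∫ x in I, (F s x - F t x) ^ 2) (𝓝[J] t) (𝓝 0) := by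
    have h0 : (0 : ℝ) = ∫ x in I, (0:ℝ) := by simp
    rw [h0]
    refine tendsto_integral_filter_of_dominated_convergence (fun x => (2 * B x) ^ 2) ?_ ?_ ?_ ?_
    · filter_upwards [self_mem_nhdsWithin] with s hs
      exact (((hmem s hs).sub (hmem t ht)).aestronglyMeasurable.pow 2)
    · filter_upwards [self_mem_nhdsWithin] with s hs
      rw [ae_restrict_iff' measurableSet_Ioo]
      refine ae_of_all _ fun x hx => ?_
      rw [Real.norm_eq_abs, abs_pow]
      have h1 := hFB s hs x hx
      have h2 := hFB t ht x hx
      have h3 := abs_sub (F s x) (F t x)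
      gcongr
      linarith
    · exact (hB.const_mul 2).integrable_sq
    · rw [ae_restrict_iff' measurableSet_Ioo]
      refine ae_of_all _ fun x hx => ?_
      have hc : ContinuousWithinAt (fun s => F s x) J t :=
        (hF.comp (f := fun s => (s, x)) (by fun_prop) fun s hs => ⟨hs, hx⟩) t ht
      have : Tendsto (fun s => (F s x - F t x) ^ 2) (𝓝[J] t) (𝓝 ((F t x - F t x) ^ 2)) :=
        (hc.sub (continuousWithinAt_const (b := F t x))).pow 2
      simpa using this
  have hsqrt := (Real.continuous_sqrt.tendsto 0).comp hsq
  rw [Real.sqrt_zero] at hsqrt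
  refine hsqrt.congr' ?_
  filter_upwards [self_mem_nhdsWithin] with s hs
  have hn := norm_toL2_sq ((hmem s hs).sub (hmem t ht))
  simp only [Pi.sub_apply] at hn
  rw [Function.comp_apply, ← hn, Real.sqrt_sq (norm_nonneg _), ← toL2_sub (hmem s hs) (hmem t ht)]
  rfl

/-! ### Strong solutions -/

/-- `w` is a strong solution of `w_t - (ρ w_x)_x = R` on `(0, T) × I`, continuous up to `t = 0`; no
boundary condition at `x = ±1` is imposed. The time derivative `wp` is an `L²(I)`-valued integrable
function, and the equation holds in `L²(I)` for almost every `t`. -/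
structure IsStrong (ρ₀ T : ℝ) (w R : ℝ → ℝ → ℝ) : Prop where
  memLp : ∀ t ∈ Icc 0 T, MemLp (w t) 2 volI
  continuousOn : ContinuousOn (Function.uncurry w) (Icc 0 T ×ˢ I)
  eqn : ∃ wp : ℝ → L2I, IntervalIntegrable wp volume 0 T ∧
    (∀ t ∈ Icc 0 T, toL2 (w t) = toL2 (w 0) + ∫ s in (0:ℝ)..t, wp s) ∧
    ∀ᵐ t, t ∈ Ioo 0 T → ∃ P z : ℝ → ℝ, HasFlux ρ₀ (w t) P z ∧
      wp t =ᵐ[volI] fun x => z x + R t x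

theorem IsPrimitiveOnI.sub {P Q z y : ℝ → ℝ} (hP : IsPrimitiveOnI P z) (hQ : IsPrimitiveOnI Q y)
    (hz : IntegrableOn z I) (hy : IntegrableOn y I) :
    IsPrimitiveOnI (fun x => P x - Q x) (fun x => z x - y x) := by
  intro a ha b hb
  rw [intervalIntegral.integral_sub (intervalIntegrable_iff.mpr (hz.mono_set (uIoc_subset_I ha hb)))
    (intervalIntegrable_iff.mpr (hy.mono_set (uIoc_subset_I ha hb))), ← hP a ha b hb,
    ← hQ a ha b hb]
  ring

theorem HasFlux.sub {ρ₀ : ℝ} {v w P Q y z : ℝ → ℝ} (hv : HasFlux ρ₀ v P y)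
    (hw : HasFlux ρ₀ w Q z) :
    HasFlux ρ₀ (fun x => v x - w x) (fun x => P x - Q x) (fun x => y x - z x) where
  memLp := hv.memLp.sub hw.memLp
  hasDerivAt x hx := ((hv.hasDerivAt x hx).sub (hw.hasDerivAt x hx)).congr_deriv (by ring)
  isPrimitive := hv.isPrimitive.sub hw.isPrimitive (integrableOn_I_of_memLp hv.memLp)
    (integrableOn_I_of_memLp hw.memLp)

theorem IsStrong.sub {ρ₀ T : ℝ} {v w R Q : ℝ → ℝ → ℝ} (hv : IsStrong ρ₀ T v R)
    (hw : IsStrong ρ₀ T w Q) :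
    IsStrong ρ₀ T (fun t x => v t x - w t x) (fun t x => R t x - Q t x) := by
  obtain ⟨vp, hvp, hvi, hve⟩ := hv.eqn
  obtain ⟨wp, hwp, hwi, hwe⟩ := hw.eqn
  refine ⟨fun t ht => (hv.memLp t ht).sub (hw.memLp t ht), hv.continuousOn.sub hw.continuousOn,
    fun t => vp t - wp t, hvp.sub hwp, fun t ht => ?_, ?_⟩
  · have h0 : (0:ℝ) ∈ Icc 0 T := ⟨le_rfl, ht.1.trans ht.2⟩
    have hsub : uIcc 0 t ⊆ uIcc 0 T := by
      rw [uIcc_of_le ht.1, uIcc_of_le h0.2]; exact Icc_subset_Icc_right ht.2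
    rw [toL2_sub (hv.memLp t ht) (hw.memLp t ht), toL2_sub (hv.memLp 0 h0) (hw.memLp 0 h0),
      hvi t ht, hwi t ht, intervalIntegral.integral_sub (hvp.mono_set hsub) (hwp.mono_set hsub)]
    abel
  · filter_upwards [hve, hwe] with t h1 h2 ht
    obtain ⟨P, y, hP, hy⟩ := h1 ht
    obtain ⟨Q', z, hQ, hz⟩ := h2 ht
    refine ⟨_, _, hP.sub hQ, ?_⟩
    filter_upwards [hy, hz, Lp.coeFn_sub (vp t) (wp t)] with x a1 a2 a3
    rw [a3, Pi.sub_apply, a1, a2]; ring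

/-- Products `a(t) b(x)` of smooth functions are strong solutions with the obvious right-hand
side; here `c = (ρ b')'`. -/
theorem isStrong_mul {ρ₀ T : ℝ} (hρ : 0 < ρ₀) {a a' b b' c : ℝ → ℝ} (ha : ∀ t, HasDerivAt a (a' t) t)
    (ha' : Continuous a') (hb : ∀ x, HasDerivAt b (b' x) x)
    (hc : ∀ x, HasDerivAt (fun y => rho ρ₀ y * b' y) (c x) x) (hcc : Continuous c) :
    IsStrong ρ₀ T (fun t x => a t * b x) (fun t x => a' t * b x - a t * c x) := by
  have hac : Continuous a := continuous_iff_continuousAt.mpr fun t => (ha t).continuousAt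
  have hbc : Continuous b := continuous_iff_continuousAt.mpr fun t => (hb t).continuousAt
  have hmem : ∀ g : ℝ → ℝ, Continuous g → MemLp g 2 volI := by
    intro g hg
    obtain ⟨C, hC⟩ := (isCompact_Icc (a := (-1:ℝ)) (b := 1)).exists_bound_of_continuousOn
      hg.continuousOn
    refine MemLp.of_bound hg.aestronglyMeasurable C ?_
    rw [ae_restrict_iff' measurableSet_Ioo]
    exact ae_of_all _ fun x hx => hC x (Ioo_subset_Icc_self hx)
  have hbm := hmem b hbc
  refine ⟨fun t _ => hbm.const_mul _, by unfold Function.uncurry; fun_prop,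
    fun t => a' t • toL2 b, (ha'.smul continuous_const).intervalIntegrable _ _, fun t _ => ?_, ?_⟩
  · rw [toL2_const_mul _ hbm, toL2_const_mul _ hbm, intervalIntegral.integral_smul_const,
      intervalIntegral.integral_eq_sub_of_hasDerivAt (fun s _ => ha s)
        (ha'.intervalIntegrable _ _), sub_smul]
    abel
  · refine ae_of_all _ fun t _ => ⟨fun x => a t * (rho ρ₀ x * b' x), fun x => a t * c x,
      ⟨(hmem c hcc).const_mul _, fun x hx => ?_, fun x _ y _ => ?_⟩, ?_⟩
    · refine ((hb x).const_mul (a t)).congr_deriv ?_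
      have := (rho_pos hρ hx).ne'
      field_simp
    · rw [intervalIntegral.integral_const_mul, intervalIntegral.integral_eq_sub_of_hasDerivAt
        (fun s _ => hc s) (hcc.intervalIntegrable _ _)]
      ring
    · filter_upwards [Lp.coeFn_smul (a' t) (toL2 b), coeFn_toL2 hbm] with x h1 h2
      rw [h1, Pi.smul_apply, h2, smul_eq_mul]; ring

/-! ### The right-hand side of the model on `[0, δ]` -/

theorem exists_abs_le_of_lipschitzOnWith {q : ℝ → ℝ} {K : ℝ≥0} (hq : LipschitzOnWith K q I) :
    ∃ M : ℝ, 0 ≤ M ∧ ∀ x ∈ I, |q x| ≤ M := by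
  refine ⟨|q 0| + K, by positivity, fun x hx => ?_⟩
  have h := hq.dist_le_mul x hx 0 zero_mem_I
  rw [Real.dist_eq, Real.dist_eq, sub_zero] at h
  have hx1 : |x| ≤ 1 := (abs_lt.mpr ⟨hx.1, hx.2⟩).le
  have h2 : (K:ℝ) * |x| ≤ K := mul_le_of_le_one_right K.2 hx1
  have h3 := abs_add_le (q x - q 0) (q 0)
  rw [sub_add_cancel] at h3
  linarith

/-- As long as `t ≤ δ` the history only sees the initial datum. -/
theorem exists_history_eq {τ δ T : ℝ} {k u₀ : ℝ → ℝ → ℝ} (hδ : 0 < δ) (hδτ : δ < τ)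
    (hk : ContinuousOn (Function.uncurry k) (Icc (-τ) 0 ×ˢ Icc (-1) 1))
    (hk0 : ∀ s ∈ Icc (-δ) 0, ∀ x ∈ Icc (-1 : ℝ) 1, k s x = 0)
    (hu₀ : ContinuousOn (Function.uncurry u₀) (Icc (-τ) 0 ×ˢ Icc (-1) 1)) (hT : T ≤ δ) :
    ∃ H : ℝ → ℝ → ℝ, Continuous (Function.uncurry H) ∧ ∀ u : ℝ → ℝ → ℝ,
      (∀ s ∈ Icc (-τ) 0, ∀ x ∈ I, u s x = u₀ s x) →
      ∀ t ∈ Icc 0 T, ∀ x ∈ I, history τ k u t x = H t x := by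
  have hτ : -τ ≤ 0 := by linarith
  let p : ℝ → ℝ := fun s => projIcc (-τ) 0 hτ s
  let r : ℝ → ℝ := fun x => projIcc (-1) 1 (by norm_num) x
  have hp : Continuous p := continuous_subtype_val.comp continuous_projIcc
  have hr : Continuous r := continuous_subtype_val.comp continuous_projIcc
  have hpm : ∀ s, p s ∈ Icc (-τ) 0 := fun s => (projIcc (-τ) 0 hτ s).2
  have hrm : ∀ s, r s ∈ Icc (-1 : ℝ) 1 := fun s => (projIcc (-1) 1 (by norm_num) s).2
  have hpe : ∀ s ∈ Icc (-τ) 0, p s = s := fun s hs => by simp [p, projIcc_of_mem hτ hs]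
  have hre : ∀ x ∈ I, r x = x := fun x hx => by
    simp [r, projIcc_of_mem (by norm_num : (-1:ℝ) ≤ 1) (Ioo_subset_Icc_self hx)]
  have hkc : Continuous fun y : (ℝ × ℝ) × ℝ => k (p y.2) (r y.1.2) :=
    hk.comp_continuous (f := fun y : (ℝ × ℝ) × ℝ => (p y.2, r y.1.2)) (by fun_prop)
      fun y => ⟨hpm _, hrm _⟩
  have huc : Continuous fun y : (ℝ × ℝ) × ℝ => u₀ (p (y.1.1 + y.2)) (r y.1.2) :=
    hu₀.comp_continuous (f := fun y : (ℝ × ℝ) × ℝ => (p (y.1.1 + y.2), r y.1.2)) (by fun_prop)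
      fun y => ⟨hpm _, hrm _⟩
  refine ⟨fun t x => ∫ s in (-τ)..0, k (p s) (r x) * u₀ (p (t + s)) (r x), ?_, ?_⟩
  · exact intervalIntegral.continuous_parametric_intervalIntegral_of_continuous'
      (f := fun (y : ℝ × ℝ) s => k (p s) (r y.2) * u₀ (p (y.1 + s)) (r y.2)) (hkc.mul huc) _ _
  · intro u hu t ht x hx
    refine intervalIntegral.integral_congr fun s hs => ?_
    rw [uIcc_of_le hτ] at hs
    rw [hpe s hs, hre x hx]
    -- For `s ≥ -δ` the kernel vanishes; for `s < -δ` the time `t + s` lies in the past.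
    rcases le_or_gt (-δ) s with h | h
    · rw [hk0 s ⟨h, hs.2⟩ x (Ioo_subset_Icc_self hx), zero_mul, zero_mul]
    · have hts : t + s ∈ Icc (-τ) 0 := ⟨by linarith [ht.1, hs.1], by linarith [ht.2]⟩
      rw [hpe _ hts, hu _ hts x hx]

/-- The quartic growth of the reaction term is matched by `ell ^ 4`, which belongs to `L²(I)`. -/
theorem StandingAssumptions.source_bound {ρ₀ τ : ℝ} {r β ε f : ℝ → ℝ} {k : ℝ → ℝ → ℝ}
    (h : StandingAssumptions ρ₀ τ r β ε f k) {q : ℝ → ℝ} (hq : Admissible q) (C : ℝ) :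
    ∃ D : ℝ, 0 ≤ D ∧ ∀ (u : ℝ → ℝ → ℝ) (t x : ℝ), 0 ≤ t → x ∈ I → |u t x| ≤ C * ell x →
      |source τ r q β ε f k u t x| ≤ D * ell x ^ 4 := by
  obtain ⟨Mr, hMr⟩ := h.r_bdd
  obtain ⟨Mβ, hMβ⟩ := h.beta_bdd
  obtain ⟨Mε, hMε⟩ := h.eps_bdd
  obtain ⟨Mf, hMf⟩ := h.f_bdd
  obtain ⟨K, hK⟩ := hq.1
  obtain ⟨Mq, hMq0, hMq⟩ := exists_abs_le_of_lipschitzOnWith hK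
  have hMr0 : 0 ≤ Mr := (abs_nonneg _).trans (hMr 0 le_rfl).1
  have hMβ0 : 0 ≤ Mβ := (abs_nonneg _).trans (hMβ 0).1
  have hMε0 : 0 ≤ Mε := (abs_nonneg _).trans (hMε 0).1
  have hMf0 : 0 ≤ Mf := (abs_nonneg _).trans (hMf 0).1
  refine ⟨Mr * Mq * Mβ + Mε * C ^ 4 + Mf, by positivity, fun u t x ht hx hu => ?_⟩
  have hl := one_le_ell hx
  have hl4 : 1 ≤ ell x ^ 4 := one_le_pow₀ hl
  have h1 : |r t * q x * β (u t x)| ≤ Mr * Mq * Mβ := by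
    rw [abs_mul, abs_mul]
    have := (hMr t ht).1
    have := hMq x hx
    have := (hMβ (u t x)).1
    gcongr
  have h2 : |ε (u t x) * |u t x| ^ 3 * u t x| ≤ Mε * (C * ell x) ^ 4 := by
    rw [abs_mul, abs_mul, abs_pow, abs_abs, mul_assoc, ← pow_succ]
    have := (hMε (u t x)).1
    gcongr
  have h3 := (hMf (history τ k u t x)).1
  have h4 : |source τ r q β ε f k u t x| ≤ |r t * q x * β (u t x)|
      + |ε (u t x) * |u t x| ^ 3 * u t x| + |f (history τ k u t x)| :=
    (abs_add_le _ _).trans (add_le_add_left (abs_sub _ _) _)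
  have h5 : Mr * Mq * Mβ ≤ Mr * Mq * Mβ * ell x ^ 4 := le_mul_of_one_le_right (by positivity) hl4
  have h6 : Mf ≤ Mf * ell x ^ 4 := le_mul_of_one_le_right hMf0 hl4
  calc _ ≤ Mr * Mq * Mβ * ell x ^ 4 + Mε * (C * ell x) ^ 4 + Mf * ell x ^ 4 := by linarith
    _ = _ := by ring

theorem StandingAssumptions.continuousOn_source {ρ₀ τ T : ℝ} {r β ε f : ℝ → ℝ} {k : ℝ → ℝ → ℝ}
    (h : StandingAssumptions ρ₀ τ r β ε f k) {q : ℝ → ℝ} (hq : Admissible q) {u H : ℝ → ℝ → ℝ}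
    (hu : ContinuousOn (Function.uncurry u) (Icc 0 T ×ˢ I)) (hH : Continuous (Function.uncurry H))
    (hHu : ∀ t ∈ Icc 0 T, ∀ x ∈ I, history τ k u t x = H t x) :
    ContinuousOn (Function.uncurry (source τ r q β ε f k u)) (Icc 0 T ×ˢ I) := by
  obtain ⟨K, hK⟩ := hq.1
  have hr : ContinuousOn (fun p : ℝ × ℝ => r p.1) (Icc 0 T ×ˢ I) :=
    h.r_C1.continuousOn.comp (by fun_prop) fun p hp => hp.1.1
  have hqc : ContinuousOn (fun p : ℝ × ℝ => q p.2) (Icc 0 T ×ˢ I) :=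
    hK.continuousOn.comp (by fun_prop) fun p hp => hp.2
  have hβ : ContinuousOn (fun p : ℝ × ℝ => β (u p.1 p.2)) (Icc 0 T ×ˢ I) :=
    h.beta_C2.continuous.comp_continuousOn hu
  have hε : ContinuousOn (fun p : ℝ × ℝ => ε (u p.1 p.2)) (Icc 0 T ×ˢ I) :=
    h.eps_C1.continuous.comp_continuousOn hu
  have hf : ContinuousOn (fun p : ℝ × ℝ => f (H p.1 p.2)) (Icc 0 T ×ˢ I) :=
    (h.f_C1.continuous.comp hH).continuousOn
  have hu' : ContinuousOn (fun p : ℝ × ℝ => u p.1 p.2) (Icc 0 T ×ˢ I) := hu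
  refine ContinuousOn.congr (((hr.mul hqc).mul hβ).sub ((hε.mul (hu'.abs.pow 3)).mul hu') |>.add hf)
    fun p hp => ?_
  simp only [Function.uncurry, source]
  rw [hHu p.1 hp.1 p.2 hp.2]
  rfl

/-- Up to time `δ` a mild solution is a strong solution. -/
theorem IsMildSolution.isStrong {ρ₀ τ T δ : ℝ} {r q β ε f : ℝ → ℝ} {k u₀ u H : ℝ → ℝ → ℝ}
    (h : StandingAssumptions ρ₀ τ r β ε f k) (hq : Admissible q)
    (hu : IsMildSolution ρ₀ τ T r q β ε f k u₀ u) (hH : Continuous (Function.uncurry H))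
    (hHu : ∀ t ∈ Icc 0 δ, ∀ x ∈ I, history τ k u t x = H t x) (hδ0 : 0 < δ) (hδT : δ ≤ T) :
    IsStrong ρ₀ δ u (source τ r q β ε f k u) := by
  have hτ := h.tau_pos
  have hsub : Icc 0 δ ⊆ Icc (-τ) T := Icc_subset_Icc (by linarith) hδT
  have hsubT : Icc 0 δ ⊆ Icc 0 T := Icc_subset_Icc_right hδT
  have hucont : ContinuousOn (Function.uncurry u) (Icc 0 δ ×ˢ I) :=
    (hu.continuousIntoV.continuousOn_uncurry h.rho_pos).mono (prod_mono_left hsub)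
  obtain ⟨C, -, hC⟩ := hu.continuousIntoV.exists_abs_le h.rho_pos
  obtain ⟨D, hD0, hD⟩ := h.source_bound hq C
  obtain ⟨hGm, hGc⟩ := continuousOn_toL2 (h.continuousOn_source hq hucont hH hHu)
    (memLp_ell_pow.const_mul D) fun t ht x hx => hD u t x ht.1 hx (hC t (hsub ht) x hx)
  obtain ⟨ut, hutm, hut⟩ := hu.memH1
  obtain ⟨Au, -, hAu⟩ := hu.memL2DA
  obtain ⟨S, hS, hdu⟩ := hu.duhamel
  have huti : IntervalIntegrable ut volume 0 T :=
    (intervalIntegrable_iff_integrableOn_Ioo_of_le (hδ0.le.trans hδT)).mpr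
      (hutm.integrable one_le_two)
  have hmem : ∀ t ∈ Icc 0 δ, MemLp (u t) 2 volI := fun t ht =>
    (hu.continuousIntoV.1 t (hsub ht)).memLp
  refine ⟨hmem, hucont, ut, huti.mono_set (by
    rwa [uIcc_of_le hδ0.le, uIcc_of_le (hδ0.le.trans hδT)]), fun t ht => hut t (hsubT ht), ?_⟩
  rw [ae_restrict_iff' measurableSet_Ioo] at hAu
  filter_upwards [hAu, huti.ae_hasDerivAt_integral] with t h1 h2 ht
  have htT : t ∈ Ioo 0 T := ⟨ht.1, ht.2.trans_le hδT⟩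
  have htI : t ∈ Icc 0 δ := Ioo_subset_Icc_self ht
  have hA := h1 htT
  obtain ⟨P, hP⟩ := hA.exists_hasFlux h.rho_pos
  refine ⟨P, Au t, hP, ?_⟩
  have hgen := (hS.generator (toL2 (u t)) (Au t)).mp
    ⟨u t, (coeFn_toL2 (hmem t htI)).symm, hA⟩
  have hslope := hS.tendsto_slope hGc (fun s hs => hdu s (hsubT hs)) ht hgen
  have hderiv : HasDerivAt (fun s => toL2 (u s)) (ut t) t := by
    have := (h2 (by rw [uIcc_of_le (htT.1.trans htT.2).le]; exact Ioo_subset_Icc_self htT) 0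
      left_mem_uIcc).const_add (toL2 (u 0))
    refine this.congr_of_eventuallyEq ?_
    filter_upwards [Icc_mem_nhds htT.1 htT.2] with s hs using hut s hs
  have hslope' := (hasDerivAt_iff_tendsto_slope_zero.mp hderiv).mono_left
    (nhdsWithin_mono 0 fun x (hx : x ∈ Ioi (0:ℝ)) => ne_of_gt hx)
  have heq := tendsto_nhds_unique hslope' hslope
  rw [heq]
  filter_upwards [Lp.coeFn_add (Au t) (toL2 (source τ r q β ε f k u t)),
    coeFn_toL2 (hGm t htI)] with x a1 a2
  rw [a1, Pi.add_apply, a2]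

/-! ### The comparison principle -/

theorem memLp_indicator_Ioc {n : ℝ → ℝ} {a b : ℝ} (hn : ContinuousOn n (Icc a b)) :
    MemLp ((Ioc a b).indicator n) 2 volI := by
  obtain ⟨B, hB⟩ := isCompact_Icc.exists_bound_of_continuousOn hn
  refine MemLp.of_bound ((aestronglyMeasurable_indicator_iff measurableSet_Ioc).mpr
    ((hn.mono Ioc_subset_Icc_self).aestronglyMeasurable measurableSet_Ioc)) (max B 0)
    (ae_of_all _ fun x => ?_)
  by_cases hx : x ∈ Ioc a b
  · rw [indicator_of_mem hx]
    exact (hB x (Ioc_subset_Icc_self hx)).trans (le_max_left _ _)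
  · rw [indicator_of_notMem hx, norm_zero]
    exact le_max_right _ _

theorem inner_toL2_indicator {n : ℝ → ℝ} {a b : ℝ} (ha : a ∈ I) (hb : b ∈ I) (hab : a ≤ b)
    (hn : ContinuousOn n (Icc a b)) (g : L2I) :
    inner ℝ (toL2 ((Ioc a b).indicator n)) g = ∫ x in a..b, n x * g x := by
  have hsub : Ioc a b ⊆ I := by
    have := uIoc_subset_I ha hb
    rwa [uIoc_of_le hab] at this
  have h1 : inner ℝ (toL2 ((Ioc a b).indicator n)) g
      = ∫ x in I, (Ioc a b).indicator (fun x => n x * g x) x := by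
    rw [L2.inner_def]
    refine integral_congr_ae ?_
    filter_upwards [coeFn_toL2 (memLp_indicator_Ioc hn)] with x hx
    rw [hx]
    by_cases hm : x ∈ Ioc a b
    · simp [hm, mul_comm]
    · simp [hm]
  rw [h1, setIntegral_indicator measurableSet_Ioc, inter_eq_self_of_subset_right hsub,
    intervalIntegral.integral_of_le hab]

/-- Weak comparison principle on the rectangle `[t₀, t₁] × [a, b]`. The energy `∫ (y⁺)²` is
absolutely continuous in time and satisfies a Gronwall inequality; the diffusion contributes to its
derivative with the favourable sign by `integral_posPart_mul_le_zero`. -/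
theorem IsStrong.nonpos {ρ₀ T : ℝ} (hρ : 0 < ρ₀) {y R : ℝ → ℝ → ℝ} (hy : IsStrong ρ₀ T y R)
    {t₀ t₁ a b C : ℝ} (h0 : 0 ≤ t₀) (h1 : t₁ ≤ T) (ha : a ∈ I) (hb : b ∈ I)
    (hinit : ∀ x ∈ Icc a b, y t₀ x ≤ 0) (hleft : ∀ t ∈ Icc t₀ t₁, y t a ≤ 0)
    (hright : ∀ t ∈ Icc t₀ t₁, y t b ≤ 0)
    (hR : ∀ t ∈ Ioo t₀ t₁, ∀ x ∈ Icc a b, 0 < y t x → R t x ≤ C * y t x) :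
    ∀ t ∈ Icc t₀ t₁, ∀ x ∈ Icc a b, y t x ≤ 0 := by
  intro t' ht' x' hx'
  have h01 : t₀ ≤ t₁ := ht'.1.trans ht'.2
  have hab : a ≤ b := hx'.1.trans hx'.2
  rcases hab.eq_or_lt with rfl | hablt
  · rw [le_antisymm hx'.2 hx'.1]; exact hleft t' ht'
  have hIab : Icc a b ⊆ I := by
    have := uIcc_subset_I ha hb
    rwa [uIcc_of_le hab] at this
  have hTsub : Icc t₀ t₁ ⊆ Icc 0 T := Icc_subset_Icc h0 h1
  have hyc : ContinuousOn (Function.uncurry y) (Icc t₀ t₁ ×ˢ Icc a b) :=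
    hy.continuousOn.mono (prod_mono hTsub hIab)
  have hyx : ∀ t ∈ Icc t₀ t₁, ContinuousOn (y t) (Icc a b) := fun t ht =>
    hyc.comp (f := fun x => (t, x)) (by fun_prop) fun x hx => ⟨ht, hx⟩
  obtain ⟨B, hB⟩ := (isCompact_Icc.prod isCompact_Icc).exists_bound_of_continuousOn hyc
  have hB0 : 0 ≤ B := (norm_nonneg _).trans (hB (t', x') ⟨ht', hx'⟩)
  set n : ℝ → ℝ → ℝ := fun t x => max (y t x) 0 with hn
  have hnx : ∀ t ∈ Icc t₀ t₁, ContinuousOn (n t) (Icc a b) := fun t ht =>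
    (hyx t ht).sup continuousOn_const
  have hii : ∀ g : ℝ → ℝ, ContinuousOn g (Icc a b) → IntervalIntegrable g volume a b :=
    fun g hg => (hg.mono (by rw [uIcc_of_le hab])).intervalIntegrable
  set E : ℝ → ℝ := fun t => ∫ x in a..b, n t x ^ 2 with hE
  have hsqi : ∀ t ∈ Icc t₀ t₁, IntervalIntegrable (fun x => n t x ^ 2) volume a b :=
    fun t ht => hii _ ((hnx t ht).pow 2)
  set N : ℝ → L2I := fun t => toL2 ((Ioc a b).indicator (n t)) with hN
  obtain ⟨yp, hyp, hyi, hye⟩ := hy.eqn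
  -- Convexity of the square of the positive part.
  have hconv : ∀ s ∈ Icc t₀ t₁, ∀ t ∈ Icc t₀ t₁,
      E t - E s ≤ 2 * inner ℝ (N t) (toL2 (y t) - toL2 (y s)) := by
    intro s hs t ht
    have hin : inner ℝ (N t) (toL2 (y t) - toL2 (y s))
        = ∫ x in a..b, n t x * (y t x - y s x) := by
      rw [hN]
      simp only
      rw [inner_toL2_indicator ha hb hab (hnx t ht)]
      refine intervalIntegral.integral_congr_ae ?_
      have hms := hy.memLp s (hTsub hs)
      have hmt := hy.memLp t (hTsub ht)
      have hae := (coeFn_toL2 (hmt.sub hms))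
      have h2 : toL2 (y t - y s) = toL2 (y t) - toL2 (y s) := toL2_sub hmt hms
      rw [h2, EventuallyEq, ae_restrict_iff' measurableSet_Ioo] at hae
      filter_upwards [hae] with x hx hxm
      rw [hx (uIoc_subset_I ha hb hxm), Pi.sub_apply]
    rw [hin, hE, ← intervalIntegral.integral_const_mul]
    simp only
    rw [← intervalIntegral.integral_sub (hsqi t ht) (hsqi s hs)]
    refine intervalIntegral.integral_mono_on hab
      ((hsqi t ht).sub (hsqi s hs))
      (hii _ (continuousOn_const.mul ((hnx t ht).mul ((hyx t ht).sub (hyx s hs))))) fun x hx => ?_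
    have e1 : n t x * y t x = n t x ^ 2 := by
      rcases le_total (y t x) 0 with h | h
      · simp [hn, max_eq_right h]
      · simp only [hn, max_eq_left h]; ring
    have e2 : y s x ≤ n s x := le_max_left _ _
    have e3 : 0 ≤ n t x := le_max_right _ _
    nlinarith [sq_nonneg (n t x - n s x), mul_le_mul_of_nonneg_left e2 e3]
  have hNn : ∀ t ∈ Icc t₀ t₁, ‖N t‖ ≤ 2 * B := by
    intro t ht
    have hm := memLp_indicator_Ioc (hnx t ht)
    have hsq := norm_toL2_sq hm
    have hle : ∫ x in I, (Ioc a b).indicator (n t) x ^ 2 ≤ ∫ x in I, B ^ 2 := by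
      refine integral_mono hm.integrable_sq (by simp) fun x => ?_
      by_cases hx : x ∈ Ioc a b
      · simp only [indicator_of_mem hx]
        have e3 : 0 ≤ n t x := le_max_right _ _
        have e4 : n t x ≤ B := max_le ((le_abs_self _).trans
          (hB (t, x) ⟨ht, Ioc_subset_Icc_self hx⟩)) hB0
        gcongr
      · simp only [indicator_of_notMem hx]
        nlinarith [sq_nonneg B]
    rw [← hsq, setIntegral_const, Measure.real, Real.volume_Ioo] at hle
    norm_num at hle
    refine abs_le_of_sq_le_sq' ?_ (by positivity) |>.2
    nlinarith [sq_nonneg B]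
  have hac : AbsolutelyContinuousOnInterval E t₀ t₁ := by
    have hsub' : uIcc t₀ t₁ ⊆ uIcc 0 T := by
      rw [uIcc_of_le h01, uIcc_of_le (h0.trans (h01.trans h1))]; exact hTsub
    have hG : IntervalIntegrable (fun s => 4 * B * ‖yp s‖) volume t₀ t₁ :=
      (hyp.mono_set hsub').norm.const_mul _
    refine absolutelyContinuousOnInterval_of_dist_le
      (hG.absolutelyContinuousOnInterval_intervalIntegral (c := t₀) left_mem_uIcc) ?_
    intro s hs t ht
    have hsub1 : uIcc t₀ s ⊆ uIcc t₀ t₁ := uIcc_subset_uIcc_left hs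
    have hsub2 : uIcc t₀ t ⊆ uIcc t₀ t₁ := uIcc_subset_uIcc_left ht
    have hYd : ‖toL2 (y t) - toL2 (y s)‖ ≤ |∫ r in s..t, ‖yp r‖| := by
      have i0 : ∀ r ∈ uIcc t₀ t₁, IntervalIntegrable yp volume 0 r := fun r hr =>
        hyp.mono_set (uIcc_subset_uIcc_left (hsub' hr))
      rw [uIcc_of_le h01] at hs ht
      rw [hyi t (hTsub ht), hyi s (hTsub hs), add_sub_add_left_eq_sub,
        intervalIntegral.integral_interval_sub_left (i0 t (by rwa [uIcc_of_le h01]))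
          (i0 s (by rwa [uIcc_of_le h01]))]
      exact intervalIntegral.norm_integral_le_abs_integral_norm
    have hGd : dist (∫ v in t₀..s, 4 * B * ‖yp v‖) (∫ v in t₀..t, 4 * B * ‖yp v‖)
        = 4 * B * |∫ r in s..t, ‖yp r‖| := by
      rw [dist_comm, Real.dist_eq, intervalIntegral.integral_interval_sub_left (hG.mono_set hsub2)
        (hG.mono_set hsub1), intervalIntegral.integral_const_mul, abs_mul,
        abs_of_nonneg (by positivity)]
    rw [hGd]
    rw [uIcc_of_le h01] at hs ht
    have c1 := (hconv s hs t ht).trans (mul_le_mul_of_nonneg_left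
      ((real_inner_le_norm _ _).trans (mul_le_mul (hNn t ht) hYd (norm_nonneg _) (by positivity)))
      zero_le_two)
    have c2 := (hconv t ht s hs).trans (mul_le_mul_of_nonneg_left
      ((real_inner_le_norm _ _).trans (mul_le_mul (hNn s hs)
        ((norm_sub_rev _ _).trans_le hYd) (norm_nonneg _) (by positivity))) zero_le_two)
    rw [Real.dist_eq, abs_le]
    constructor <;> linarith
  have hEt0 : E t₀ ≤ 0 := by
    have : E t₀ = ∫ x in a..b, (0:ℝ) := by
      refine intervalIntegral.integral_congr fun x hx => ?_
      rw [uIcc_of_le hab] at hx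
      simp [hn, max_eq_right (hinit x hx)]
    rw [this]; simp
  have hder : ∀ᵐ t, t ∈ Ioo t₀ t₁ → deriv E t ≤ 2 * C * E t := by
    filter_upwards [hac.ae_differentiableAt, hyp.ae_hasDerivAt_integral, hye] with t d1 d2 d3 ht
    have htI := Ioo_subset_Icc_self ht
    have htT : t ∈ Ioo 0 T := ⟨h0.trans_lt ht.1, ht.2.trans_le h1⟩
    have hEd := (d1 (by rwa [uIcc_of_le h01])).hasDerivAt
    have hYd : HasDerivAt (fun s => toL2 (y s)) (yp t) t := by
      have := (d2 (by rw [uIcc_of_le (htT.1.trans htT.2).le]; exact Ioo_subset_Icc_self htT) 0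
        left_mem_uIcc).const_add (toL2 (y 0))
      refine this.congr_of_eventuallyEq ?_
      filter_upwards [Icc_mem_nhds htT.1 htT.2] with s hs using hyi s hs
    -- By convexity the difference below is minimal at `s = t`.
    have hφ : HasDerivAt (fun s => E s - 2 * inner ℝ (N t) (toL2 (y s)))
        (deriv E t - 2 * inner ℝ (N t) (yp t)) t := by
      have := (((innerSL ℝ (N t)).hasFDerivAt.comp_hasDerivAt t hYd).const_mul 2)
      exact hEd.sub this
    have hmin : IsLocalMin (fun s => E s - 2 * inner ℝ (N t) (toL2 (y s))) t := by
      filter_upwards [Icc_mem_nhds ht.1 ht.2] with s hs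
      have := hconv s hs t htI
      rw [inner_sub_right] at this
      linarith
    have hE' : deriv E t = 2 * inner ℝ (N t) (yp t) := by
      linarith [hmin.hasDerivAt_eq_zero hφ]
    obtain ⟨P, z, hP, hz⟩ := d3 htT
    have hzi : IntegrableOn z I := integrableOn_I_of_memLp hP.memLp
    have hnz := integral_posPart_mul_le_zero hab ha hb (continuous_rho ρ₀).continuousOn
      (fun x hx => rho_pos hρ hx) hP.hasDerivAt hP.isPrimitive hzi (hleft t htI) (hright t htI)
    rw [hE', hN]
    simp only
    rw [inner_toL2_indicator ha hb hab (hnx t htI)]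
    have hsubI := uIoc_subset_I ha hb
    have hnc : ContinuousOn (n t) (uIcc a b) := by rw [uIcc_of_le hab]; exact hnx t htI
    have izz : IntervalIntegrable (fun x => n t x * z x) volume a b :=
      (intervalIntegrable_iff.mpr (hzi.mono_set hsubI)).continuousOn_mul hnc
    have iyp : IntervalIntegrable (fun x => n t x * yp t x) volume a b :=
      (intervalIntegrable_iff.mpr ((integrableOn_I_of_memLp (Lp.memLp (yp t))).mono_set
        hsubI)).continuousOn_mul hnc
    have inn : IntervalIntegrable (fun x => C * n t x ^ 2) volume a b :=
      hii _ (continuousOn_const.mul ((hnx t htI).pow 2))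
    have hle : ∫ x in a..b, n t x * yp t x ≤ ∫ x in a..b, (n t x * z x + C * n t x ^ 2) := by
      refine intervalIntegral.integral_mono_ae_restrict hab iyp (izz.add inn) ?_
      rw [EventuallyEq, ae_restrict_iff' measurableSet_Ioo] at hz
      rw [EventuallyLE, ae_restrict_iff' measurableSet_Icc]
      filter_upwards [hz] with x hx hxm
      rw [hx (hIab hxm)]
      rcases le_or_gt (y t x) 0 with h | h
      · simp [hn, max_eq_right h]
      · have := hR t ht x hxm h
        simp only [hn, max_eq_left h.le]
        nlinarith
    rw [intervalIntegral.integral_add izz inn, intervalIntegral.integral_const_mul] at hle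
    have : (∫ x in a..b, n t x * z x) ≤ 0 := hnz
    simp only [hE]
    linarith
  have hfin := nonpos_of_ae_deriv_le_mul hac hEt0 hder t' ht'
  by_contra! hc
  have : 0 < E t' := by
    refine intervalIntegral.integral_pos hablt ((hnx t' ht').pow 2) (fun x _ => sq_nonneg _)
      ⟨x', hx', ?_⟩
    have : 0 < n t' x' := lt_max_of_lt_left hc
    positivity
  linarith

/-! ### Positivity and the Hopf lemma via explicit barriers -/

theorem rho_le {ρ₀ x : ℝ} (hρ : 0 < ρ₀) : rho ρ₀ x ≤ ρ₀ := by
  unfold rho; nlinarith [mul_nonneg hρ.le (sq_nonneg x)]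

theorem hasDerivAt_rho (ρ₀ x : ℝ) : HasDerivAt (rho ρ₀) (-(2 * ρ₀ * x)) x := by
  have := (((hasDerivAt_id x).pow 2).const_sub 1).const_mul ρ₀
  refine this.congr_deriv ?_
  simp; ring

/-- A solution starting from zero becomes positive wherever its source is positive. The barrier is
`κ t - c ((x - x₁)² + A t)²`: the subtracted square solves `Z_t ≥ (ρ Z_x)_x` and absorbs the unknown
lateral values, but at `x = x₁` it is only quadratic in `t`. -/
theorem IsStrong.exists_pos {ρ₀ T : ℝ} (hρ : 0 < ρ₀) {W R : ℝ → ℝ → ℝ} (hW : IsStrong ρ₀ T W R)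
    {t₁ x₁ η κ : ℝ} (ht₁ : 0 < t₁) (ht₁T : t₁ ≤ T) (hη : 0 < η) (hκ : 0 < κ)
    (hI : Icc (x₁ - η) (x₁ + η) ⊆ I) (h0 : ∀ x ∈ Icc (x₁ - η) (x₁ + η), W 0 x = 0)
    (hR : ∀ t ∈ Icc 0 t₁, ∀ x ∈ Icc (x₁ - η) (x₁ + η), κ ≤ R t x) :
    ∃ t₂, 0 < t₂ ∧ t₂ ≤ t₁ ∧ ∀ t ∈ Ioc 0 t₂, 0 < W t x₁ := by
  have hx₁ : x₁ ∈ Icc (x₁ - η) (x₁ + η) := ⟨by linarith, by linarith⟩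
  have ha : x₁ - η ∈ I := hI ⟨le_rfl, by linarith⟩
  have hb : x₁ + η ∈ I := hI ⟨by linarith, le_rfl⟩
  obtain ⟨B, hB⟩ := (isCompact_Icc.prod isCompact_Icc).exists_bound_of_continuousOn
    (hW.continuousOn.mono (prod_mono (Icc_subset_Icc_right ht₁T) hI))
  have hB' : ∀ t ∈ Icc 0 t₁, ∀ x ∈ Icc (x₁ - η) (x₁ + η), -B ≤ W t x := fun t ht x hx =>
    (abs_le.mp (hB (t, x) ⟨ht, hx⟩)).1
  have hB0 : 0 ≤ B := (norm_nonneg _).trans (hB (0, x₁) ⟨⟨le_rfl, ht₁.le⟩, hx₁⟩)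
  -- `A` makes `((x - x₁)² + A t)²` a supersolution; `c` makes the barrier at most `-B` on the
  -- lateral boundary.
  set A : ℝ := 14 * ρ₀ with hA
  set c : ℝ := (B + κ * t₁) / η ^ 4 with hc
  have hc0 : 0 < c := by positivity
  have hcη : c * η ^ 4 = B + κ * t₁ := by rw [hc]; field_simp
  have hA0 : 0 < A := by positivity
  have s1 : IsStrong ρ₀ T (fun t x => (κ * t - c * A ^ 2 * t ^ 2) * 1)
      (fun t x => (κ - c * A ^ 2 * (2 * t)) * 1 - (κ * t - c * A ^ 2 * t ^ 2) * 0) := by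
    refine isStrong_mul hρ (a := fun t => κ * t - c * A ^ 2 * t ^ 2)
      (a' := fun t => κ - c * A ^ 2 * (2 * t)) (b := fun _ => 1) (b' := fun _ => 0)
      (c := fun _ => 0) (fun t => ?_) (by fun_prop) (fun x => hasDerivAt_const x 1)
      (fun x => ?_) continuous_const
    · refine (((hasDerivAt_id t).const_mul κ).sub
        (((hasDerivAt_id t).pow 2).const_mul (c * A ^ 2))).congr_deriv ?_
      simp
    · simpa using hasDerivAt_const x (0:ℝ)
  have hξ : ∀ x, HasDerivAt (fun y => y - x₁) 1 x := fun x => (hasDerivAt_id x).sub_const x₁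
  have s2 : IsStrong ρ₀ T (fun t x => c * (x - x₁) ^ 4)
      (fun t x => 0 * (x - x₁) ^ 4 -
        c * (-(2 * ρ₀ * x) * (4 * (x - x₁) ^ 3) + rho ρ₀ x * (12 * (x - x₁) ^ 2))) := by
    refine isStrong_mul hρ (a := fun _ => c) (a' := fun _ => 0) (b := fun x => (x - x₁) ^ 4)
      (b' := fun x => 4 * (x - x₁) ^ 3)
      (c := fun x => -(2 * ρ₀ * x) * (4 * (x - x₁) ^ 3) + rho ρ₀ x * (12 * (x - x₁) ^ 2))
      (fun t => hasDerivAt_const t c) continuous_const (fun x => ?_) (fun x => ?_) ?_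
    · refine ((hξ x).pow 4).congr_deriv ?_
      simp
    · refine ((hasDerivAt_rho ρ₀ x).mul (((hξ x).pow 3).const_mul 4)).congr_deriv ?_
      simp only [Pi.pow_apply]; push_cast; ring
    · have := continuous_rho ρ₀
      fun_prop
  have s3 : IsStrong ρ₀ T (fun t x => (2 * A * c * t) * (x - x₁) ^ 2)
      (fun t x => (2 * A * c) * (x - x₁) ^ 2 -
        (2 * A * c * t) * (-(2 * ρ₀ * x) * (2 * (x - x₁)) + rho ρ₀ x * 2)) := by
    refine isStrong_mul hρ (a := fun t => 2 * A * c * t) (a' := fun _ => 2 * A * c)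
      (b := fun x => (x - x₁) ^ 2) (b' := fun x => 2 * (x - x₁))
      (c := fun x => -(2 * ρ₀ * x) * (2 * (x - x₁)) + rho ρ₀ x * 2)
      (fun t => ?_) continuous_const (fun x => ?_) (fun x => ?_) ?_
    · simpa using (hasDerivAt_id t).const_mul (2 * A * c)
    · refine ((hξ x).pow 2).congr_deriv ?_
      simp
    · refine ((hasDerivAt_rho ρ₀ x).mul ((hξ x).const_mul 2)).congr_deriv ?_
      simp
    · have := continuous_rho ρ₀
      fun_prop
  have hcmp := (((s1.sub s2).sub s3).sub hW).nonpos hρ (t₀ := 0) (t₁ := t₁) (C := 0) le_rfl ht₁T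
    ha hb ?_ ?_ ?_ ?_
  · refine ⟨min t₁ (κ / (2 * (c * A ^ 2))), lt_min ht₁ (by positivity), min_le_left _ _,
      fun t ht => ?_⟩
    have ht1 : t ≤ t₁ := ht.2.trans (min_le_left _ _)
    have ht2 : t ≤ κ / (2 * (c * A ^ 2)) := ht.2.trans (min_le_right _ _)
    have := hcmp t ⟨ht.1.le, ht1⟩ x₁ hx₁
    rw [le_div_iff₀ (by positivity)] at ht2
    simp only [sub_self] at this
    have ht0 := ht.1
    nlinarith [mul_le_mul_of_nonneg_left ht2 ht0.le]
  · intro x hx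
    rw [h0 x hx]
    have : 0 ≤ c * (x - x₁) ^ 4 := by positivity
    linarith
  · intro t ht
    have h1 := hB' t ht _ ⟨le_rfl, by linarith⟩
    have e1 : (x₁ - η - x₁) = -η := by ring
    rw [e1]
    have e2 : 0 ≤ c * A ^ 2 * t ^ 2 := by positivity
    have e3 : 0 ≤ 2 * A * c * t * (-η) ^ 2 := mul_nonneg (mul_nonneg (by positivity) ht.1) (sq_nonneg _)
    have e4 : κ * t ≤ κ * t₁ := mul_le_mul_of_nonneg_left ht.2 hκ.le
    have e5 : c * (-η) ^ 4 = B + κ * t₁ := by rw [← hcη]; ring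
    rw [e5]
    linarith
  · intro t ht
    have h1 := hB' t ht (x₁ + η) ⟨by linarith, le_rfl⟩
    have e1 : (x₁ + η - x₁) = η := by ring
    rw [e1]
    have e2 : 0 ≤ c * A ^ 2 * t ^ 2 := by positivity
    have e3 : 0 ≤ 2 * A * c * t * η ^ 2 := mul_nonneg (mul_nonneg (by positivity) ht.1) (sq_nonneg _)
    have e4 : κ * t ≤ κ * t₁ := mul_le_mul_of_nonneg_left ht.2 hκ.le
    linarith
  · intro t ht x hx _
    have hRt := hR t (Ioo_subset_Icc_self ht) x hx
    have hxI := hI hx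
    set ξ := x - x₁ with hξ'
    have hξ2 : |ξ| ≤ 2 := by
      have := hI hx₁
      rw [hξ', abs_le]; constructor <;> linarith [hxI.1, hxI.2, this.1, this.2]
    have hr := rho_le (x := x) hρ
    have hx1 : |x| ≤ 1 := (abs_lt.mpr ⟨hxI.1, hxI.2⟩).le
    have hxξ : |x * ξ| ≤ 2 := by
      rw [abs_mul]
      nlinarith [abs_nonneg x, abs_nonneg ξ]
    have hxξ' := (abs_le.mp hxξ).1
    -- This says that `Z = (ξ² + A t)²` is a supersolution: `(ρ Z_x)_x ≤ Z_t`.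
    have key : rho ρ₀ x * (12 * ξ ^ 2 + 4 * A * t) - 8 * ρ₀ * (x * ξ) * (ξ ^ 2 + A * t)
        ≤ 2 * A * (ξ ^ 2 + A * t) := by
      have k0 : 0 ≤ ξ ^ 2 + A * t := by have := ht.1.le; positivity
      have k1 : rho ρ₀ x * (12 * ξ ^ 2 + 4 * A * t) ≤ ρ₀ * (12 * (ξ ^ 2 + A * t)) := by
        have : 0 ≤ A * t := by have := ht.1.le; positivity
        refine mul_le_mul hr (by nlinarith) (by nlinarith [sq_nonneg ξ]) hρ.le
      have k2 : -(8 * ρ₀ * (x * ξ) * (ξ ^ 2 + A * t)) ≤ 16 * ρ₀ * (ξ ^ 2 + A * t) := by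
        have := mul_le_mul_of_nonneg_right hxξ' (mul_nonneg hρ.le k0)
        nlinarith
      have k3 : 2 * A * (ξ ^ 2 + A * t) = 28 * (ρ₀ * (ξ ^ 2 + A * t)) := by rw [hA]; ring
      nlinarith
    have key' := mul_le_mul_of_nonneg_left key hc0.le
    nlinarith

/-- A form of the Hopf lemma on the segment between `x₀` and `x₁`: a nonnegative supersolution
which vanishes at `x₀` and is positive at `x₁` has nonzero slope at `x₀`. The barrier is an
exponential front travelling from `x₁` to `x₀`. -/
theorem IsStrong.not_hasDerivAt_zero {ρ₀ T : ℝ} (hρ : 0 < ρ₀) {W R : ℝ → ℝ → ℝ}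
    (hW : IsStrong ρ₀ T W R) {t₁ x₀ x₁ L : ℝ} (ht₁ : 0 < t₁) (ht₁T : t₁ ≤ T) (hx₀ : x₀ ∈ I)
    (hx₁ : x₁ ∈ I) (hne : x₀ ≠ x₁) (hL : 0 ≤ L)
    (hR : ∀ t ∈ Icc 0 t₁, ∀ x ∈ uIcc x₀ x₁, -(L * W t x) ≤ R t x)
    (hnn : ∀ t ∈ Icc 0 t₁, ∀ x ∈ uIcc x₀ x₁, 0 ≤ W t x)
    (hpos : ∀ t ∈ Ioc 0 t₁, 0 < W t x₁) (hzero : W t₁ x₀ = 0) :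
    ¬HasDerivAt (W t₁) 0 x₀ := by
  intro hder
  -- The sign `σ` treats the cases `x₀ < x₁` and `x₁ < x₀` simultaneously.
  set l := |x₁ - x₀| with hl
  have hl0 : 0 < l := abs_pos.mpr (sub_ne_zero.mpr hne.symm)
  obtain ⟨σ, hσ2, hσl, hσ, hseg, hray⟩ : ∃ σ : ℝ, σ ^ 2 = 1 ∧ σ * (x₁ - x₀) = l ∧ |σ| = 1 ∧
      (∀ x ∈ uIcc x₀ x₁, σ * (x - x₁) ≤ 0) ∧ ∀ s ∈ Icc 0 l, x₀ + σ * s ∈ uIcc x₀ x₁ := by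
    rcases lt_or_gt_of_ne hne with h | h
    · have hle : l = x₁ - x₀ := by rw [hl, abs_of_pos (by linarith)]
      refine ⟨1, by norm_num, by rw [hle]; ring, by simp, fun x hx => ?_, fun s hs => ?_⟩
      · rw [uIcc_of_le h.le] at hx; linarith [hx.2]
      · rw [uIcc_of_le h.le]; constructor <;> linarith [hs.1, hs.2]
    · have hle : l = x₀ - x₁ := by rw [hl, abs_of_neg (by linarith)]; ring
      refine ⟨-1, by norm_num, by rw [hle]; ring, by simp, fun x hx => ?_, fun s hs => ?_⟩
      · rw [uIcc_of_ge h.le] at hx; linarith [hx.1]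
      · rw [uIcc_of_ge h.le]; constructor <;> linarith [hs.1, hs.2]
  have hsegI : uIcc x₀ x₁ ⊆ I := uIcc_subset_I hx₀ hx₁
  obtain ⟨xm, hxm, hmin⟩ := (isCompact_uIcc (a := x₀) (b := x₁)).exists_isMinOn nonempty_uIcc
    (continuous_rho ρ₀).continuousOn
  set ρm := rho ρ₀ xm with hρm
  have hρm0 : 0 < ρm := rho_pos hρ (hsegI hxm)
  set t₀ := t₁ / 2 with ht₀
  -- The speed at which the front covers the segment during `[t₀, t₁]`.
  set lam := l / (t₁ - t₀) with hlam
  have htt : 0 < t₁ - t₀ := by rw [ht₀]; linarith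
  have hlam0 : 0 < lam := by positivity
  have hlamt : lam * (t₁ - t₀) = l := by rw [hlam]; field_simp
  -- With this rate the diffusion term `ρ α²` beats the speed of the front, the drift `ρ' α` and the
  -- zeroth order term `L`.
  set α := (lam + 2 * ρ₀ + L) / ρm + 1 with hα
  have hα1 : 1 ≤ α := by rw [hα]; linarith [show 0 ≤ (lam + 2 * ρ₀ + L) / ρm by positivity]
  have hα0 : 0 < α := by linarith
  have hαρ : lam + 2 * ρ₀ + L ≤ ρm * α := by
    have : ρm * α = lam + 2 * ρ₀ + L + ρm := by rw [hα]; field_simp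
    linarith
  have hWx₁ : ContinuousOn (fun t => W t x₁) (Icc t₀ t₁) :=
    hW.continuousOn.comp (f := fun t => (t, x₁)) (by fun_prop)
      fun t ht => ⟨⟨by linarith [ht.1], ht.2.trans ht₁T⟩, hx₁⟩
  obtain ⟨tm, htm, htmin⟩ := isCompact_Icc.exists_isMinOn (nonempty_Icc.mpr (by linarith)) hWx₁
  set μ := W tm x₁ with hμ
  have hμ0 : 0 < μ := hpos tm ⟨by linarith [htm.1], htm.2⟩
  set κ := μ / Real.exp (α * l) with hκ
  have hκ0 : 0 < κ := by positivity
  have hκμ : κ * Real.exp (α * l) = μ := by rw [hκ]; field_simp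
  have hexp : ∀ t, HasDerivAt (fun t => κ * Real.exp (α * lam * (t - t₀)))
      (α * lam * (κ * Real.exp (α * lam * (t - t₀)))) t := fun t => by
    refine ((((hasDerivAt_id t).sub_const t₀).const_mul (α * lam)).exp.const_mul κ).congr_deriv ?_
    simp; ring
  have hexpx : ∀ x, HasDerivAt (fun x => Real.exp (α * σ * (x - x₁)))
      (α * σ * Real.exp (α * σ * (x - x₁))) x := fun x => by
    refine (((hasDerivAt_id x).sub_const x₁).const_mul (α * σ)).exp.congr_deriv ?_
    simp; ring
  have s1 := isStrong_mul (T := T) hρ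
    (a := fun t => κ * Real.exp (α * lam * (t - t₀)))
    (a' := fun t => α * lam * (κ * Real.exp (α * lam * (t - t₀))))
    (b := fun x => Real.exp (α * σ * (x - x₁)))
    (b' := fun x => α * σ * Real.exp (α * σ * (x - x₁)))
    (c := fun x => -(2 * ρ₀ * x) * (α * σ * Real.exp (α * σ * (x - x₁)))
      + rho ρ₀ x * (α * σ * (α * σ * Real.exp (α * σ * (x - x₁)))))
    hexp (by fun_prop) hexpx
    (fun x => (hasDerivAt_rho ρ₀ x).mul ((hexpx x).const_mul (α * σ)))
    (by have := continuous_rho ρ₀; fun_prop)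
  have s2 := isStrong_mul (T := T) hρ (a := fun _ => κ) (a' := fun _ => 0) (b := fun _ => 1)
    (b' := fun _ => 0) (c := fun _ => 0) (fun t => hasDerivAt_const t κ) continuous_const
    (fun x => hasDerivAt_const x 1) (fun x => by simpa using hasDerivAt_const x (0:ℝ))
    continuous_const
  have hval : ∀ t x, κ * Real.exp (α * lam * (t - t₀)) * Real.exp (α * σ * (x - x₁))
      = κ * Real.exp (α * (lam * (t - t₀) + σ * (x - x₁))) := fun t x => by
    rw [mul_assoc, ← Real.exp_add]; ring_nf
  have hle : ∀ e : ℝ, e ≤ 0 → κ * Real.exp (α * e) ≤ κ := fun e he =>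
    mul_le_of_le_one_right hκ0.le (Real.exp_le_one_iff.mpr (mul_nonpos_of_nonneg_of_nonpos hα0.le he))
  have hends : ∀ x, x = x₀ ∨ x = x₁ → ∀ t ∈ Icc t₀ t₁,
      κ * Real.exp (α * lam * (t - t₀)) * Real.exp (α * σ * (x - x₁)) - κ * 1 - W t x ≤ 0 := by
    rintro x (rfl | rfl) t ht
    · have ht0 : t ∈ Icc 0 t₁ := ⟨by linarith [ht.1], ht.2⟩
      have h1 := hnn t ht0 x left_mem_uIcc
      have h2 : lam * (t - t₀) ≤ l := by
        rw [← hlamt]; exact mul_le_mul_of_nonneg_left (by linarith [ht.2]) hlam0.le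
      have h3 := hle (lam * (t - t₀) + σ * (x - x₁)) (by linarith)
      rw [hval]
      linarith
    · have h1 : μ ≤ W t x := htmin ht
      have h2 : lam * (t - t₀) ≤ l := by
        rw [← hlamt]; exact mul_le_mul_of_nonneg_left (by linarith [ht.2]) hlam0.le
      have h3 : κ * Real.exp (α * (lam * (t - t₀) + σ * (x - x))) ≤ μ := by
        rw [← hκμ, sub_self, mul_zero, add_zero]
        gcongr
      rw [hval]
      linarith
  have hminI : min x₀ x₁ ∈ I := hsegI ⟨le_rfl, min_le_max⟩
  have hmaxI : max x₀ x₁ ∈ I := hsegI ⟨min_le_max, le_rfl⟩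
  have hcmp := ((s1.sub s2).sub hW).nonpos hρ (t₀ := t₀) (t₁ := t₁) (C := 0) (by positivity) ht₁T
    hminI hmaxI ?_ (hends _ (min_choice x₀ x₁)) (hends _ (max_choice x₀ x₁)) ?_
  · -- At time `t₁` the front has reached `x₀`, where the barrier has slope `κ α`.
    have hlow : ∀ s ∈ Icc 0 l, κ * α * s ≤ W t₁ (x₀ + σ * s) := by
      intro s hs
      have h1 := hcmp t₁ ⟨by linarith, le_rfl⟩ _ (hray s hs)
      rw [hval, hlamt] at h1
      have h2 : l + σ * (x₀ + σ * s - x₁) = s := by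
        rw [← hσl]; linear_combination s * hσ2
      rw [h2] at h1
      have h3 := Real.add_one_le_exp (α * s)
      nlinarith
    have hg : HasDerivAt (fun s => W t₁ (x₀ + σ * s)) 0 0 := by
      have h1 : HasDerivAt (fun s => x₀ + σ * s) (σ * 1) 0 :=
        ((hasDerivAt_id (0:ℝ)).const_mul σ).const_add x₀
      have h2 : HasDerivAt (W t₁) 0 (x₀ + σ * 0) := by simpa using hder
      exact (h2.comp (0:ℝ) h1).congr_deriv (zero_mul _)
    have hs := (hasDerivAt_iff_tendsto_slope_zero.mp hg).mono_left
      (nhdsWithin_mono 0 fun x (hx : x ∈ Ioi (0:ℝ)) => ne_of_gt hx)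
    have hge : κ * α ≤ 0 := by
      refine ge_of_tendsto hs ?_
      filter_upwards [Ioo_mem_nhdsGT hl0] with s hs'
      have := hlow s (Ioo_subset_Icc_self hs')
      simp only [zero_add, mul_zero, add_zero, hzero, sub_zero, smul_eq_mul]
      rw [inv_mul_eq_div, le_div_iff₀ hs'.1]
      exact this
    nlinarith [mul_pos hκ0 hα0]
  · intro x hx
    have h1 := hnn t₀ ⟨by linarith, by linarith⟩ x hx
    rw [hval, sub_self, mul_zero, zero_add]
    have := hle _ (hseg x hx)
    linarith
  · intro t ht x hx hy
    have ht' : t ∈ Icc 0 t₁ := ⟨by linarith [ht.1], ht.2.le⟩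
    have h1 := hnn t ht' x hx
    have h2 := hR t ht' x hx
    have hxI := hsegI hx
    set e := Real.exp (α * σ * (x - x₁)) with he
    set a := κ * Real.exp (α * lam * (t - t₀)) with ha
    have hae : 0 < a * e := by positivity
    have hWle : L * W t x ≤ L * (a * e) := mul_le_mul_of_nonneg_left (by linarith) hL
    have hρx : ρm ≤ rho ρ₀ x := hmin hx
    have hxσ : x * σ ≤ 1 := by
      refine (le_abs_self _).trans ?_
      rw [abs_mul, hσ, mul_one]
      exact (abs_lt.mpr ⟨hxI.1, hxI.2⟩).le
    have hbr : α * lam + 2 * ρ₀ * (x * σ) * α - rho ρ₀ x * α ^ 2 + L ≤ 0 := by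
      have k1 : ρm * α ^ 2 ≤ rho ρ₀ x * α ^ 2 := mul_le_mul_of_nonneg_right hρx (sq_nonneg _)
      have k2 : 2 * ρ₀ * (x * σ) * α ≤ 2 * ρ₀ * α := by
        have := mul_le_mul_of_nonneg_left hxσ (mul_nonneg hρ.le hα0.le)
        linarith
      have k3 : L ≤ L * α := le_mul_of_one_le_right hL hα1
      have k4 := mul_le_mul_of_nonneg_right hαρ hα0.le
      linarith
    have hfin := mul_nonpos_of_nonneg_of_nonpos hae.le hbr
    have hid : α * lam * a * e - a * (-(2 * ρ₀ * x) * (α * σ * e) + rho ρ₀ x * (α * σ * (α * σ * e)))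
        = a * e * (α * lam + 2 * ρ₀ * (x * σ) * α - rho ρ₀ x * α ^ 2) := by
      linear_combination (-(a * e * rho ρ₀ x * α ^ 2)) * hσ2
    rw [hid]
    linarith

/-! ### Sign changes of piecewise analytic functions -/

theorem sum_indicator_Ico_eq {n : ℕ} {p : Fin (n + 1) → ℝ} (hp : StrictMono p)
    (φ : Fin n → ℝ → ℝ) {j : Fin n} {x : ℝ} (hx : x ∈ Ico (p j.castSucc) (p j.succ)) :
    ∑ i : Fin n, (Ico (p i.castSucc) (p i.succ)).indicator (φ i) x = φ j x := by
  rw [Finset.sum_eq_single j, indicator_of_mem hx]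
  · intro i _ hij
    refine indicator_of_notMem (fun hxi => ?_) _
    rcases lt_or_gt_of_ne hij with h | h
    · have : p i.succ ≤ p j.castSucc := hp.monotone (Fin.succ_le_castSucc_iff.mpr h)
      linarith [hxi.2, hx.1]
    · have : p j.succ ≤ p i.castSucc := hp.monotone (Fin.succ_le_castSucc_iff.mpr h)
      linarith [hxi.1, hx.2]
  · simp

theorem PiecewiseAnalytic.exists_analytic_right {ψ : ℝ → ℝ} (h : PiecewiseAnalytic ψ) {s : ℝ}
    (hs : s ∈ I) : ∃ φ : ℝ → ℝ, AnalyticAt ℝ φ s ∧ ∀ᶠ x in 𝓝[>] s, ψ x = φ x := by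
  obtain ⟨-, n, p, φ, hp, hp0, hp1, hφ, hψ⟩ := h
  obtain ⟨j, hj1, hj2⟩ : ∃ j : Fin n, p j.castSucc ≤ s ∧ s < p j.succ := by
    by_contra! hc
    have : ∀ i : Fin (n + 1), p i ≤ s := fun i =>
      Fin.induction (motive := fun i => p i ≤ s) (by rw [hp0]; exact hs.1.le)
        (fun i hi => hc i hi) i
    have := this (Fin.last n)
    rw [hp1] at this
    exact absurd hs.2 this.not_gt
  refine ⟨φ j, hφ j s ⟨hj1, hj2.le⟩, ?_⟩
  filter_upwards [Ioo_mem_nhdsGT hj2, Ioo_mem_nhdsGT hs.2] with x hx hx1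
  rw [hψ x ⟨hs.1.trans hx1.1, hx1.2⟩, sum_indicator_Ico_eq hp φ ⟨hj1.trans hx.1.le, hx.2⟩]

theorem PiecewiseAnalytic.exists_analytic_left {ψ : ℝ → ℝ} (h : PiecewiseAnalytic ψ) {s : ℝ}
    (hs : s ∈ I) : ∃ φ : ℝ → ℝ, AnalyticAt ℝ φ s ∧ ∀ᶠ x in 𝓝[<] s, ψ x = φ x := by
  obtain ⟨-, n, p, φ, hp, hp0, hp1, hφ, hψ⟩ := h
  obtain ⟨j, hj1, hj2⟩ : ∃ j : Fin n, p j.castSucc < s ∧ s ≤ p j.succ := by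
    by_contra! hc
    have : ∀ i : Fin (n + 1), p i < s := fun i =>
      Fin.induction (motive := fun i => p i < s) (by rw [hp0]; exact hs.1)
        (fun i hi => hc i hi) i
    have := this (Fin.last n)
    rw [hp1] at this
    exact absurd hs.2 this.not_gt
  refine ⟨φ j, hφ j s ⟨hj1.le, hj2⟩, ?_⟩
  filter_upwards [Ioo_mem_nhdsLT hj1, Ioo_mem_nhdsLT hs.1] with x hx hx1
  rw [hψ x ⟨hx1.1, hx1.2.trans hs.2⟩, sum_indicator_Ico_eq hp φ ⟨hx.1.le, hx.2.trans_le hj2⟩]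

/-- On the right of each point of `I`, `d` either vanishes identically or has no zeros. -/
def RightDichotomy (d : ℝ → ℝ) : Prop :=
  ∀ s ∈ I, (∀ᶠ x in 𝓝[>] s, d x = 0) ∨ ∀ᶠ x in 𝓝[>] s, d x ≠ 0

theorem RightDichotomy.exists_signed {d : ℝ → ℝ} (h : RightDichotomy d) (hd : ContinuousOn d I)
    {x₀ y : ℝ} (hx₀ : x₀ ∈ I) (hy : y ∈ I) (hxy : x₀ < y) (hdy : d y ≠ 0) :
    ∃ x₁ ∈ I, x₀ < x₁ ∧ d x₁ ≠ 0 ∧ ∀ x ∈ Icc x₀ x₁, 0 ≤ d x * d x₁ := by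
  set A := {x ∈ Icc x₀ y | d x ≠ 0} with hA
  have hAy : y ∈ A := ⟨⟨hxy.le, le_rfl⟩, hdy⟩
  have hbdd : BddBelow A := ⟨x₀, fun x hx => hx.1.1⟩
  set s := sInf A with hs
  have hxs : x₀ ≤ s := le_csInf ⟨y, hAy⟩ fun x hx => hx.1.1
  have hsy : s ≤ y := csInf_le hbdd hAy
  have hsI : s ∈ I := ⟨hx₀.1.trans_le hxs, hsy.trans_lt hy.2⟩
  have hzero : ∀ x, x₀ ≤ x → x < s → d x = 0 := by
    intro x h1 h2
    by_contra hne
    exact absurd (csInf_le hbdd ⟨⟨h1, h2.le.trans hsy⟩, hne⟩) h2.not_ge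
  -- Since `s` is the infimum of the nonzero set, `d` cannot vanish identically on its right.
  rcases h s hsI with h0 | h0
  · exfalso
    obtain ⟨b, hb, hsub⟩ := (mem_nhdsGT_iff_exists_Ioo_subset).mp h0
    have hdat : ContinuousAt d s := hd.continuousAt (isOpen_Ioo.mem_nhds hsI)
    have hds : d s = 0 := by
      have h1 : Tendsto d (𝓝[>] s) (𝓝 (d s)) := hdat.mono_left nhdsWithin_le_nhds
      have h2 : Tendsto d (𝓝[>] s) (𝓝 0) :=
        tendsto_const_nhds.congr' (h0.mono fun x hx => hx.symm)
      exact tendsto_nhds_unique h1 h2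
    have : b ≤ s := le_csInf ⟨y, hAy⟩ fun x hx => by
      by_contra! hxb
      have h1 : s ≤ x := csInf_le hbdd hx
      rcases h1.eq_or_lt with h2 | h2
      · exact hx.2 (h2 ▸ hds)
      · exact hx.2 (hsub ⟨h2, hxb⟩)
    exact absurd hb this.not_gt
  · obtain ⟨b, hb, hsub⟩ := (mem_nhdsGT_iff_exists_Ioo_subset).mp h0
    obtain ⟨x₁, h1, h2⟩ := exists_between (lt_min hb hsI.2)
    have hx₁b := h2.trans_le (min_le_left _ _)
    have hx₁I : x₁ ∈ I := ⟨hsI.1.trans h1, h2.trans_le (min_le_right _ _)⟩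
    have hne : d x₁ ≠ 0 := hsub ⟨h1, hx₁b⟩
    refine ⟨x₁, hx₁I, hxs.trans_lt h1, hne, fun x hx => ?_⟩
    rcases lt_or_ge x s with hxs' | hxs'
    · rw [hzero x hx.1 hxs', zero_mul]
    · by_contra! hneg
      have hc : ContinuousOn (fun y => d y * d x₁) (Icc x x₁) :=
        (hd.mono (Icc_subset_Ioo (hsI.1.trans_le hxs') hx₁I.2)).mul continuousOn_const
      have hmem : (0:ℝ) ∈ Ioo (d x * d x₁) (d x₁ * d x₁) := ⟨hneg, mul_self_pos.mpr hne⟩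
      obtain ⟨c, hcm, hc0⟩ := intermediate_value_Ioo hx.2 hc hmem
      exact hsub ⟨hxs'.trans_lt hcm.1, hcm.2.trans hx₁b⟩ (by simpa [hne] using hc0)

theorem dichotomy_of_analyticAt {d φ : ℝ → ℝ} {s : ℝ} {l : Filter ℝ} (hl : l ≤ 𝓝[≠] s)
    (hφ : AnalyticAt ℝ φ s) (h : ∀ᶠ x in l, d x = φ x) :
    (∀ᶠ x in l, d x = 0) ∨ ∀ᶠ x in l, d x ≠ 0 := by
  rcases hφ.eventually_eq_zero_or_eventually_ne_zero with h0 | h0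
  · left
    filter_upwards [h, hl (nhdsWithin_le_nhds h0)] with x h1 h2
    rw [h1]; exact h2
  · right
    filter_upwards [h, hl h0] with x h1 h2
    rw [h1]; exact h2

/-- If two piecewise analytic functions differ, then on one side of any given point `x₀` their
difference is of one sign up to a point where it does not vanish. -/
theorem exists_signed_sub {q p : ℝ → ℝ} (hq : PiecewiseAnalytic q) (hp : PiecewiseAnalytic p)
    {x₀ y : ℝ} (hx₀ : x₀ ∈ I) (hy : y ∈ I) (hqp : q y ≠ p y) :
    ∃ x₁ ∈ I, x₀ ≠ x₁ ∧ q x₁ ≠ p x₁ ∧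
      ∀ x ∈ uIcc x₀ x₁, 0 ≤ (q x - p x) * (q x₁ - p x₁) := by
  have hc : ContinuousOn (fun x => q x - p x) I := hq.1.sub hp.1
  have hR : RightDichotomy fun x => q x - p x := by
    intro s hs
    obtain ⟨φ, hφ, h1⟩ := hq.exists_analytic_right hs
    obtain ⟨χ, hχ, h2⟩ := hp.exists_analytic_right hs
    refine dichotomy_of_analyticAt (nhdsWithin_mono s fun x (hx : x ∈ Ioi s) => ne_of_gt hx)
      (hφ.sub hχ) ?_
    filter_upwards [h1, h2] with x e1 e2
    rw [e1, e2]; rfl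
  have hnegI : ∀ {x : ℝ}, x ∈ I → -x ∈ I := fun {x} hx => ⟨by linarith [hx.2], by linarith [hx.1]⟩
  -- The left side of `x₀` is reduced to the right side by reflection.
  have hL : RightDichotomy fun x => q (-x) - p (-x) := by
    intro s hs
    obtain ⟨φ, hφ, h1⟩ := hq.exists_analytic_left (hnegI hs)
    obtain ⟨χ, hχ, h2⟩ := hp.exists_analytic_left (hnegI hs)
    have h3 : ∀ᶠ x in 𝓝[<] (-s), q x - p x = (φ - χ) x := by
      filter_upwards [h1, h2] with x e1 e2
      rw [e1, e2]; rfl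
    have := dichotomy_of_analyticAt (nhdsWithin_mono (-s) fun x (hx : x ∈ Iio (-s)) => ne_of_lt hx)
      (hφ.sub hχ) h3
    have ht : Tendsto (fun x : ℝ => -x) (𝓝[>] s) (𝓝[<] (-s)) := tendsto_neg_nhdsGT
    exact this.imp (fun h => ht.eventually h) fun h => ht.eventually h
  obtain ⟨y', hy', hne, hqp'⟩ : ∃ y' ∈ I, y' ≠ x₀ ∧ q y' ≠ p y' := by
    by_cases hyx : y = x₀
    · subst hyx
      have hev := ((hc.continuousAt (isOpen_Ioo.mem_nhds hy)).eventually_ne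
        (sub_ne_zero.mpr hqp)).filter_mono (nhdsWithin_le_nhds (s := Ioi y))
      obtain ⟨y', h1, h2, h3⟩ := (hev.and ((Ioo_mem_nhdsGT hy.2))).exists
      exact ⟨y', ⟨hy.1.trans h2, h3⟩, ne_of_gt h2, sub_ne_zero.mp h1⟩
    · exact ⟨y, hy, hyx, hqp⟩
  rcases lt_or_gt_of_ne hne with hlt | hlt
  · have hcneg : ContinuousOn (fun x => q (-x) - p (-x)) I :=
      hc.comp (f := fun x => -x) (by fun_prop) fun x hx => hnegI hx
    obtain ⟨x₁, h1, h2, h3, h4⟩ := hL.exists_signed hcneg (hnegI hx₀) (hnegI hy')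
      (neg_lt_neg hlt) (by simpa [sub_ne_zero] using hqp')
    refine ⟨-x₁, hnegI h1, fun h => ?_, sub_ne_zero.mp h3, fun x hx => ?_⟩
    · rw [h, neg_neg] at h2
      exact lt_irrefl _ h2
    · rw [uIcc_of_ge (by linarith)] at hx
      simpa using h4 (-x) ⟨neg_le_neg hx.2, by linarith [hx.1]⟩
  · obtain ⟨x₁, h1, h2, h3, h4⟩ := hR.exists_signed hc hx₀ hy' hlt (sub_ne_zero.mpr hqp')
    exact ⟨x₁, h1, h2.ne, sub_ne_zero.mp h3, fun x hx => h4 x (by rwa [uIcc_of_le h2.le] at hx)⟩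

/-! ### The equation for the difference of two solutions -/

theorem abs_cube_mul_sub_le {a b B : ℝ} (ha : |a| ≤ B) (hb : |b| ≤ B) :
    |(|a| ^ 3 * a - |b| ^ 3 * b)| ≤ 4 * B ^ 3 * |a - b| := by
  have hB : 0 ≤ B := (abs_nonneg a).trans ha
  have h1 : |a| ^ 3 * a - |b| ^ 3 * b = |a| ^ 3 * (a - b)
      + b * ((|a| - |b|) * (|a| ^ 2 + |a| * |b| + |b| ^ 2)) := by ring
  have h2 : |(|a| ^ 3 * (a - b))| ≤ B ^ 3 * |a - b| := by
    rw [abs_mul, abs_pow, abs_abs]; gcongr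
  have h3 : |b * ((|a| - |b|) * (|a| ^ 2 + |a| * |b| + |b| ^ 2))|
      ≤ B * (|a - b| * (B ^ 2 + B * B + B ^ 2)) := by
    rw [abs_mul, abs_mul, abs_of_nonneg (by positivity : 0 ≤ |a| ^ 2 + |a| * |b| + |b| ^ 2)]
    have := abs_abs_sub_abs_le_abs_sub a b
    gcongr
  rw [h1]
  refine (abs_add_le _ _).trans ((add_le_add h2 h3).trans (le_of_eq (by ring)))

theorem abs_sub_le_of_deriv_le {g : ℝ → ℝ} {M : ℝ} (hg : ContDiff ℝ 1 g) (hM : ∀ v, |deriv g v| ≤ M)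
    (a b : ℝ) : |g a - g b| ≤ M * |a - b| :=
  convex_univ.norm_image_sub_le_of_norm_deriv_le
    (fun x _ => (hg.differentiable (by norm_num)).differentiableAt) (fun x _ => hM x)
    (mem_univ b) (mem_univ a)

/-- Two sources with the same history differ by `r (q - p) β(v)` up to a term which is Lipschitz in
`u - v`. -/
theorem StandingAssumptions.abs_source_sub_le {ρ₀ τ : ℝ} {r β ε f : ℝ → ℝ} {k : ℝ → ℝ → ℝ}
    (h : StandingAssumptions ρ₀ τ r β ε f k) {q : ℝ → ℝ} (hq : Admissible q) (B : ℝ) :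
    ∃ L : ℝ, 0 ≤ L ∧ ∀ (p : ℝ → ℝ) (u v : ℝ → ℝ → ℝ) (t x : ℝ), 0 ≤ t → x ∈ I → |u t x| ≤ B →
      |v t x| ≤ B → history τ k u t x = history τ k v t x →
      |source τ r q β ε f k u t x - source τ r p β ε f k v t x
        - r t * β (v t x) * (q x - p x)| ≤ L * |u t x - v t x| := by
  obtain ⟨Mr, hMr⟩ := h.r_bdd
  obtain ⟨Mβ, hMβ⟩ := h.beta_bdd
  obtain ⟨Mε, hMε⟩ := h.eps_bdd
  obtain ⟨K, hK⟩ := hq.1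
  obtain ⟨Mq, hMq0, hMq⟩ := exists_abs_le_of_lipschitzOnWith hK
  have hMr0 : 0 ≤ Mr := (abs_nonneg _).trans (hMr 0 le_rfl).1
  have hMβ0 : 0 ≤ Mβ := (abs_nonneg _).trans (hMβ 0).1
  have hMε0 : 0 ≤ Mε := (abs_nonneg _).trans (hMε 0).1
  refine ⟨Mr * Mq * Mβ + Mε * B ^ 4 + Mε * (4 * |B| ^ 3), by positivity,
    fun p u v t x ht hx hu hv hH => ?_⟩
  have hB0 : 0 ≤ B := (abs_nonneg _).trans hu
  have hd : source τ r q β ε f k u t x - source τ r p β ε f k v t x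
      - r t * β (v t x) * (q x - p x)
      = r t * q x * (β (u t x) - β (v t x))
        - (ε (u t x) - ε (v t x)) * (|u t x| ^ 3 * u t x)
        - ε (v t x) * (|u t x| ^ 3 * u t x - |v t x| ^ 3 * v t x) := by
    simp only [source, hH]; ring
  have hβl := abs_sub_le_of_deriv_le (h.beta_C2.of_le (by norm_num)) (fun w => (hMβ w).2.1)
    (u t x) (v t x)
  have hεl := abs_sub_le_of_deriv_le h.eps_C1 (fun w => (hMε w).2) (u t x) (v t x)
  have hcl := abs_cube_mul_sub_le hu hv
  have e1 : |r t * q x * (β (u t x) - β (v t x))| ≤ Mr * Mq * (Mβ * |u t x - v t x|) := by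
    rw [abs_mul, abs_mul]
    have := (hMr t ht).1
    have := hMq x hx
    gcongr
  have e2 : |(ε (u t x) - ε (v t x)) * (|u t x| ^ 3 * u t x)| ≤ Mε * |u t x - v t x| * B ^ 4 := by
    rw [abs_mul, abs_mul, abs_pow, abs_abs, ← pow_succ]
    gcongr
  have e3 : |ε (v t x) * (|u t x| ^ 3 * u t x - |v t x| ^ 3 * v t x)|
      ≤ Mε * (4 * B ^ 3 * |u t x - v t x|) := by
    rw [abs_mul]
    have := (hMε (v t x)).1
    gcongr
  rw [hd]
  refine (abs_sub _ _).trans ((add_le_add_left (abs_sub _ _) _).trans ?_)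
  rw [abs_of_nonneg hB0]
  linarith

theorem IsStrong.ae_differentiableAt {ρ₀ T : ℝ} {w R : ℝ → ℝ → ℝ} (hw : IsStrong ρ₀ T w R) :
    ∀ᵐ t, t ∈ Ioo 0 T → ∀ x ∈ I, DifferentiableAt ℝ (w t) x := by
  obtain ⟨wp, -, -, h⟩ := hw.eqn
  filter_upwards [h] with t h ht x hx
  obtain ⟨P, z, hP, -⟩ := h ht
  exact (hP.hasDerivAt x hx).differentiableAt

/-- The core of the uniqueness argument: if the source of `u` strictly exceeds that of `v` in the
sense that `q ≥ p` between `x₀` and `x₁` and `q > p` at `x₁`, then `u` and `v` cannot have the same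
Cauchy data at `x₀`. -/
theorem IsStrong.false_of_signed {ρ₀ τ T : ℝ} {r β ε f : ℝ → ℝ} {k u v : ℝ → ℝ → ℝ} {q p : ℝ → ℝ}
    (h : StandingAssumptions ρ₀ τ r β ε f k) (hr : ∀ t : ℝ, 0 ≤ t → 0 < r t) (hβ : ∀ v, 0 < β v)
    (hq : Admissible q) (hp : Admissible p)
    (hu : IsStrong ρ₀ T u (source τ r q β ε f k u)) (hv : IsStrong ρ₀ T v (source τ r p β ε f k v))
    (hH : ∀ t ∈ Icc 0 T, ∀ x ∈ I, history τ k u t x = history τ k v t x) (hT : 0 < T)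
    (h0 : ∀ x ∈ I, u 0 x = v 0 x) {x₀ x₁ : ℝ} (hx₀ : x₀ ∈ I) (hx₁ : x₁ ∈ I) (hne : x₀ ≠ x₁)
    (hsign : ∀ x ∈ uIcc x₀ x₁, 0 ≤ q x - p x) (hpos : 0 < q x₁ - p x₁)
    (hobs : ∀ t ∈ Ioo 0 T, u t x₀ = v t x₀ ∧ deriv (u t) x₀ = deriv (v t) x₀) : False := by
  have hW := hu.sub hv
  have hρ := h.rho_pos
  -- A compact neighbourhood of the segment inside `I`.
  obtain ⟨a, ha1, ha2⟩ := exists_between (lt_min hx₀.1 hx₁.1)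
  obtain ⟨b, hb1, hb2⟩ := exists_between (max_lt hx₀.2 hx₁.2)
  have hKI : Icc a b ⊆ I := Icc_subset_Ioo ha1 hb2
  have hsegK : uIcc x₀ x₁ ⊆ Icc a b := Icc_subset_Icc ha2.le hb1.le
  have hx₁K : x₁ ∈ Ioo a b := ⟨ha2.trans_le (min_le_right _ _), (le_max_right _ _).trans_lt hb1⟩
  obtain ⟨B₁, hB₁⟩ := (isCompact_Icc.prod isCompact_Icc).exists_bound_of_continuousOn
    (hu.continuousOn.mono (prod_mono_right hKI))
  obtain ⟨B₂, hB₂⟩ := (isCompact_Icc.prod isCompact_Icc).exists_bound_of_continuousOn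
    (hv.continuousOn.mono (prod_mono_right hKI))
  obtain ⟨L, hL0, hL⟩ := h.abs_source_sub_le hq (max B₁ B₂)
  have hlow : ∀ t ∈ Icc 0 T, ∀ x ∈ Icc a b,
      r t * β (v t x) * (q x - p x) - L * |u t x - v t x|
        ≤ source τ r q β ε f k u t x - source τ r p β ε f k v t x := by
    intro t ht x hx
    have := hL p u v t x ht.1 (hKI hx) ((hB₁ (t, x) ⟨ht, hx⟩).trans (le_max_left _ _))
      ((hB₂ (t, x) ⟨ht, hx⟩).trans (le_max_right _ _)) (hH t ht x (hKI hx))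
    linarith [(abs_le.mp this).1]
  -- Near `(0, x₁)` the right-hand side is bounded below by a positive constant.
  set κ := r 0 * β (v 0 x₁) * (q x₁ - p x₁) with hκ
  have hκ0 : 0 < κ := mul_pos (mul_pos (hr 0 le_rfl) (hβ _)) hpos
  have hcont : ContinuousWithinAt (fun z : ℝ × ℝ =>
      r z.1 * β (v z.1 z.2) * (q z.2 - p z.2) - L * |u z.1 z.2 - v z.1 z.2|)
      (Icc 0 T ×ˢ I) (0, x₁) := by
    have c1 : ContinuousOn (fun z : ℝ × ℝ => r z.1) (Icc 0 T ×ˢ I) :=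
      h.r_C1.continuousOn.comp (by fun_prop) fun z hz => hz.1.1
    have c2 : ContinuousOn (fun z : ℝ × ℝ => β (v z.1 z.2)) (Icc 0 T ×ˢ I) :=
      h.beta_C2.continuous.comp_continuousOn hv.continuousOn
    have c3 : ContinuousOn (fun z : ℝ × ℝ => q z.2 - p z.2) (Icc 0 T ×ˢ I) :=
      (hq.2.1.sub hp.2.1).comp (f := Prod.snd) (by fun_prop) fun z hz => hz.2
    have c4 : ContinuousOn (fun z : ℝ × ℝ => |u z.1 z.2 - v z.1 z.2|) (Icc 0 T ×ˢ I) :=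
      hW.continuousOn.abs
    exact (((c1.mul c2).mul c3).sub (continuousOn_const.mul c4)) _ ⟨⟨le_rfl, hT.le⟩, hx₁⟩
  have hev := hcont.eventually_const_lt (u := κ / 2) (by
    simp only [h0 x₁ hx₁, sub_self, abs_zero, mul_zero, sub_zero]
    linarith)
  obtain ⟨η, hη0, hη⟩ : ∃ η > 0, ∀ t ∈ Icc 0 T, ∀ x ∈ I, t < η → |x - x₁| < η →
      κ / 2 ≤ r t * β (v t x) * (q x - p x) - L * |u t x - v t x| := by
    obtain ⟨η, hη0, hη⟩ := Metric.mem_nhdsWithin_iff.mp hev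
    refine ⟨η, hη0, fun t ht x hx h1 h2 => ?_⟩
    have hball : (t, x) ∈ Metric.ball ((0 : ℝ), x₁) η := by
      rw [Metric.mem_ball, Prod.dist_eq, Real.dist_eq, Real.dist_eq, sub_zero, abs_of_nonneg ht.1]
      exact max_lt h1 h2
    exact le_of_lt (hη ⟨hball, ht, hx⟩)
  set θ := min (η / 2) (min (x₁ - a) (b - x₁)) with hθ
  have hθ0 : 0 < θ := lt_min (by positivity) (lt_min (by linarith [hx₁K.1]) (by linarith [hx₁K.2]))
  have hθ1 : θ ≤ η / 2 := min_le_left _ _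
  have hθ2 : θ ≤ x₁ - a := (min_le_right _ _).trans (min_le_left _ _)
  have hθ3 : θ ≤ b - x₁ := (min_le_right _ _).trans (min_le_right _ _)
  have hθK : Icc (x₁ - θ) (x₁ + θ) ⊆ Icc a b := Icc_subset_Icc (by linarith) (by linarith)
  obtain ⟨t₂, ht₂0, ht₂, hWpos⟩ := hW.exists_pos hρ (t₁ := min (T / 2) (η / 2)) (κ := κ / 2)
    (lt_min (by positivity) (by positivity)) ((min_le_left _ _).trans (by linarith)) hθ0
    (by positivity) (hθK.trans hKI) (fun x hx => sub_eq_zero.mpr (h0 x (hKI (hθK hx))))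
    fun t ht x hx => by
      have htT : t ∈ Icc 0 T := ⟨ht.1, (ht.2.trans (min_le_left _ _)).trans (by linarith)⟩
      refine (hη t htT x (hKI (hθK hx)) ?_ ?_).trans (hlow t htT x (hθK hx))
      · have := ht.2.trans (min_le_right _ _); linarith
      · rw [abs_lt]; constructor <;> linarith [hx.1, hx.2]
  have ht₂T : t₂ < T := (ht₂.trans (min_le_left _ _)).trans_lt (by linarith)
  -- Between `x₀` and `x₁` the difference is a supersolution, hence nonnegative.
  have hsup : ∀ t ∈ Icc 0 t₂, ∀ x ∈ uIcc x₀ x₁, -(L * |u t x - v t x|)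
      ≤ source τ r q β ε f k u t x - source τ r p β ε f k v t x := by
    intro t ht x hx
    have := hlow t ⟨ht.1, ht.2.trans ht₂T.le⟩ x (hsegK hx)
    have h3 := mul_nonneg (mul_pos (hr t ht.1) (hβ (v t x))).le (hsign x hx)
    linarith
  have hWx₀ : ∀ t ∈ Icc 0 t₂, u t x₀ - v t x₀ = 0 := by
    intro t ht
    rcases ht.1.eq_or_lt with h1 | h1
    · rw [← h1, h0 x₀ hx₀, sub_self]
    · rw [(hobs t ⟨h1, ht.2.trans_lt ht₂T⟩).1, sub_self]
  have hWx₁ : ∀ t ∈ Icc 0 t₂, 0 ≤ u t x₁ - v t x₁ := by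
    intro t ht
    rcases ht.1.eq_or_lt with h1 | h1
    · rw [← h1, h0 x₁ hx₁, sub_self]
    · exact (hWpos t ⟨h1, ht.2⟩).le
  have hends : ∀ x, x = x₀ ∨ x = x₁ → ∀ t ∈ Icc 0 t₂, v t x - u t x ≤ 0 := by
    rintro x (rfl | rfl) t ht
    · linarith [hWx₀ t ht]
    · linarith [hWx₁ t ht]
  have hsegI := hsegK.trans hKI
  have hnn := (hv.sub hu).nonpos hρ (t₀ := 0) (t₁ := t₂) (C := L) le_rfl ht₂T.le
    (hsegI ⟨le_rfl, min_le_max⟩) (hsegI ⟨min_le_max, le_rfl⟩)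
    (fun x hx => by simp only [h0 x (hsegI hx), sub_self, le_refl])
    (hends _ (min_choice x₀ x₁)) (hends _ (max_choice x₀ x₁)) fun t ht x hx hy => by
      have h1 := hsup t (Ioo_subset_Icc_self ht) x hx
      rw [abs_sub_comm, abs_of_pos hy] at h1
      linarith
  -- Some time at which both solutions are differentiable at `x₀`.
  have hbad : (ae (volume.restrict (Ioo 0 t₂))).NeBot := by
    rw [ae_neBot, Ne, Measure.restrict_eq_zero, Real.volume_Ioo]
    simpa using ht₂0
  obtain ⟨t₁, ⟨h1, h2⟩, ht₁⟩ := ((ae_restrict_of_ae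
    (hu.ae_differentiableAt.and hv.ae_differentiableAt)).and
      (ae_restrict_mem (measurableSet_Ioo (a := 0) (b := t₂)))).exists
  have ht₁T : t₁ ∈ Ioo 0 T := ⟨ht₁.1, ht₁.2.trans ht₂T⟩
  have hsub : Icc 0 t₁ ⊆ Icc 0 t₂ := Icc_subset_Icc_right ht₁.2.le
  have hnn' : ∀ t ∈ Icc 0 t₁, ∀ x ∈ uIcc x₀ x₁, 0 ≤ u t x - v t x := fun t ht x hx => by
    have := hnn t (hsub ht) x hx
    linarith
  refine hW.not_hasDerivAt_zero hρ ht₁.1 ht₁T.2.le hx₀ hx₁ hne hL0 (fun t ht x hx => ?_) hnn'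
    (fun t ht => hWpos t ⟨ht.1, ht.2.trans ht₁.2.le⟩) (hWx₀ t₁ (Ioo_subset_Icc_self ht₁)) ?_
  · have := hsup t (hsub ht) x hx
    rwa [abs_of_nonneg (hnn' t ht x hx)] at this
  · refine ((h1 ht₁T x₀ hx₀).hasDerivAt.sub (h2 ht₁T x₀ hx₀).hasDerivAt).congr_deriv ?_
    rw [(hobs t₁ ht₁T).2, sub_self]

end EBM

theorem mainTheorem2
    (ρ₀ τ : ℝ) (r β ε f : ℝ → ℝ) (k : ℝ → ℝ → ℝ)
    (hstanding : EBM.StandingAssumptions ρ₀ τ r β ε f k)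
    (hk : ∃ δ : ℝ, 0 < δ ∧ δ < τ ∧
      ∀ s ∈ Set.Icc (-δ) 0, ∀ x ∈ Set.Icc (-1 : ℝ) 1, k s x = 0)
    (hr : ∀ t : ℝ, 0 ≤ t → 0 < r t)
    (hβ : ∀ v : ℝ, 0 < β v)
    (q qt : ℝ → ℝ) (hq : EBM.Admissible q) (hqt : EBM.Admissible qt)
    (u₀ : ℝ → ℝ → ℝ) (hu₀ : EBM.IsC12 τ u₀)
    (T : ℝ) (hT : 0 < T)
    (u ut : ℝ → ℝ → ℝ)
    (hu : EBM.IsMildSolution ρ₀ τ T r q β ε f k u₀ u)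
    (hut : EBM.IsMildSolution ρ₀ τ T r qt β ε f k u₀ ut)
    (x₀ : ℝ) (hx₀ : x₀ ∈ EBM.I)
    (hobs : ∀ t ∈ Set.Ioo 0 T, u t x₀ = ut t x₀ ∧ deriv (u t) x₀ = deriv (ut t) x₀) :
    ∀ x ∈ EBM.I, q x = qt x := by
  obtain ⟨δ, hδ0, hδτ, hk0⟩ := hk
  intro y hy
  by_contra hne
  obtain ⟨x₁, hx₁, hx₀₁, hq₁, hsign⟩ := EBM.exists_signed_sub hq.2 hqt.2 hx₀ hy hne
  set S := min δ T with hS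
  have hS0 : 0 < S := lt_min hδ0 hT
  have hST : S ≤ T := min_le_right _ _
  obtain ⟨H, hHc, hH⟩ := EBM.exists_history_eq hδ0 hδτ hstanding.k_C1.continuousOn hk0 hu₀.1
    (min_le_left δ T)
  have hHu := hH u hu.initial
  have hHut := hH ut hut.initial
  have su := hu.isStrong hstanding hq hHc hHu hS0 hST
  have sut := hut.isStrong hstanding hqt hHc hHut hS0 hST
  have hτ := hstanding.tau_pos
  have h0 : ∀ x ∈ EBM.I, u 0 x = ut 0 x := fun x hx => by
    rw [hu.initial 0 ⟨by linarith, le_rfl⟩ x hx, hut.initial 0 ⟨by linarith, le_rfl⟩ x hx]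
  have hhist : ∀ t ∈ Icc 0 S, ∀ x ∈ EBM.I,
      EBM.history τ k u t x = EBM.history τ k ut t x := fun t ht x hx => by
    rw [hHu t ht x hx, hHut t ht x hx]
  have hobs' : ∀ t ∈ Ioo 0 S, u t x₀ = ut t x₀ ∧ deriv (u t) x₀ = deriv (ut t) x₀ :=
    fun t ht => hobs t ⟨ht.1, ht.2.trans_le hST⟩
  rcases lt_or_gt_of_ne hq₁ with hlt | hlt
  · refine sut.false_of_signed hstanding hr hβ hqt hq su (fun t ht x hx => (hhist t ht x hx).symm)
      hS0 (fun x hx => (h0 x hx).symm) hx₀ hx₁ hx₀₁ (fun x hx => ?_) (sub_pos.mpr hlt)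
      fun t ht => ⟨(hobs' t ht).1.symm, (hobs' t ht).2.symm⟩
    have := nonpos_of_mul_nonneg_left (hsign x hx) (sub_neg.mpr hlt)
    linarith
  · exact su.false_of_signed hstanding hr hβ hq hqt sut hhist hS0 h0 hx₀ hx₁ hx₀₁
      (fun x hx => nonneg_of_mul_nonneg_left (hsign x hx) (sub_pos.mpr hlt)) (sub_pos.mpr hlt) hobs'
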